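/- **Setting.** Let $n\ge 2$ and let $\Omega\subset\mathbb{R}^n$ be a bounded domain (open and connected) with Lipschitz boundary. Let $A\subset\subset\Omega$ be open (possibly empty), with Lipschitz boundary and finitely many connected components, and assume that $B:=\Omega\setminus\overline A$ is again a domain. Let $1<p,q<+\infty$ and $r:=\min\{p,q\}$. For an open set $U$ and an exponent $s>1$ consider the following conditions on $\sigma(x,E)$, where $x\in U$, $E\ge 0$ and $\mathbf E,\mathbf E_1,\mathbf E_2\in\mathbb{R}^n$, and $\sigma(x,|\mathbf E|)\mathbf E$ is read as $0$ at $\mathbf E=0$. * $\mathrm{(C)}_U$: $x\mapsto\sigma(x,E)$ is Lebesgue measurable on $U$ for every $E>0$, and $E\mapsto\sigma(x,E)$ is continuous on $(0,+\infty)$ for a.e. $x\in U$. * $\mathrm{(G)}_{s,U}$: there are constants $0<\underline\sigma\le\overline\sigma$ and $E_0>0$ such that for a.e. $x\in U$ and all $E>0$: $\underline\sigma (E/E_0)^{s-2}\le\sigma(x,E)\le\overline\sigma\,[1+(E/E_0)^{s-2}]$ if $s\ge 2$, and $\underline\sigma (E/E_0)^{s-2}\le\sigma(x,E)\le\overline\sigma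 (E/E_0)^{s-2}$ if $1<s<2$. * $\mathrm{(M)}_{s,U}$: there is $\kappa>0$ such that for a.e. $x\in U$ and all $\mathbf E_1,\mathbf E_2\in\mathbb{R}^n$ the quantity $(\sigma(x,|\mathbf E_2|)\mathbf E_2-\sigma(x,|\mathbf E_1|)\mathbf E_1)\cdot(\mathbf E_2-\mathbf E_1)$ is at least $\kappa|\mathbf E_2-\mathbf E_1|^s$ if $s\ge 2$, and at least $\kappa(1+|\mathbf E_2|^2+|\mathbf E_1|^2)^{\frac{s-2}{2}}|\mathbf E_2-\mathbf E_1|^2$ if $1<s<2$. Write $Q_\sigma(x,E)=\int_0^E\sigma(x,\xi)\,\xi\,d\xi$. Boundary data are represented by Sobolev functions: for $u,g\in W^{1,s}(\Omega)$, "$u=g$ on $\partial\Omega$" means $u-g\in W^{1,s}_0(\Omega)$, the closure of $C^1_c(\Omega)$ in $W^{1,s}(\Omega)$; for $u,g\in W^{1,s}(B)$ it means that $u-g$ lies in the closure in $W^{1,s}(B)$ of the restrictions to $B$ of the functions in $C^1_c(\Omega)$. **Proposition.** Assume that $\sigma$ satisfies $\mathrm{(C)}_B$, $\mathrm{(G)}_{p,B}$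 and $\mathrm{(M)}_{p,B}$, and let $f\in W^{1,p}(\Omega)$. In each of the cases below let $u^{f}$, respectively $u^{f+\varepsilon\varphi}$ for $\varepsilon>0$, be a minimizer of the stated problem with $g=f$, respectively $g=f+\varepsilon\varphi$. * (i) If $A=\emptyset$, the problem is to minimize $\int_\Omega Q_\sigma(x,|\nabla u|)\,dx$ among $u\in W^{1,p}(\Omega)$ with $u=g$ on $\partial\Omega$. Then, for every $\varphi\in W^{1,p}(\Omega)$, $\nabla u^{f+\varepsilon\varphi}\to\nabla u^f$ in $L^p(\Omega)$ as $\varepsilon\to0^+$. * (ii) (Two phases.) If $\sigma$ also satisfies $\mathrm{(C)}_A$, $\mathrm{(G)}_{q,A}$ and $\mathrm{(M)}_{q,A}$, the problem is to minimize $\int_B Q_\sigma(x,|\nabla u|)\,dx+\int_A Q_\sigma(x,|\nabla u|)\,dx$ (a value in $[0,+\infty]$) among $u\in W^{1,p}(\Omega)\cup W^{1,q}(\Omega)=W^{1,r}(\Omega)$ with $u=g$ on $\partial\Omega$ (that is, $u-g\in W^{1,r}_0(\Omega)$). Then, for every $\varphi\in W^{1,r}(\Omega)\cap W^{1,p}(B)\cap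 W^{1,q}(A)$, as $\varepsilon\to0^+$, $\nabla u^{f+\varepsilon\varphi}\to\nabla u^f$ in $L^p(B)$, in $L^q(A)$ and in $L^r(\Omega)$. * (iii) (Perfect electric insulator in $A$, $\sigma=0$ in $A$.) The problem is to minimize $\int_B Q_\sigma(x,|\nabla u|)\,dx$ among $u\in W^{1,p}(B)$ with $u=g$ on $\partial\Omega$. Then, for every $\varphi\in W^{1,p}(B)$ (for instance the restriction of a function in $W^{1,p}(\Omega)$), $\nabla u^{f+\varepsilon\varphi}\to\nabla u^f$ in $L^p(B)$ as $\varepsilon\to0^+$. * (iv) (Perfect electric conductor in $A$, $\sigma=+\infty$ in $A$.) The problem is to minimize $\int_B Q_\sigma(x,|\nabla u|)\,dx$ among $u\in W^{1,p}(\Omega)$ with $u=g$ on $\partial\Omega$ and $\nabla u=0$ a.e. in $A$. Then, for every $\varphi\in W^{1,p}(\Omega)$, $\nabla u^{f+\varepsilon\varphi}\to\nabla u^f$ in $L^p(B)$ as $\varepsilon\to0^+$. In each case the convergence includes the assertion that the gradients belong to the space named. -/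

import Mathlib

open MeasureTheory Set Filter Topology
open scoped ENNReal NNReal ContDiff

namespace PiecewiseNonlinear

noncomputable section

/-- `ℝⁿ` with its Euclidean norm. -/
abbrev Rn (n : ℕ) : Type := EuclideanSpace ℝ (Fin n)

/-! ### Geometry -/

/-- `U` has a Lipschitz boundary: near each boundary point, `U` is the strict epigraph of a Lipschitz
function of the `n - 1` variables orthogonal to some unit direction `ν` (the component of `y`
orthogonal to `ν` is `y - ⟪ν, y⟫ ν`). -/
def HasLipschitzBoundary {n : ℕ} (U : Set (Rn n)) : Prop :=
  ∀ x ∈ frontier U, ∃ (ν : Rn n) (r : ℝ) (K : ℝ≥0) (γ : Rn n → ℝ),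
    ‖ν‖ = 1 ∧ 0 < r ∧ LipschitzWith K γ ∧
      ∀ y ∈ Metric.ball x r, (y ∈ U ↔ γ (y - inner ℝ ν y • ν) < inner ℝ ν y)

/-- The region occupied by the second (outer) material, `B = Ω \ closure A`. -/
def outer {n : ℕ} (Ω A : Set (Rn n)) : Set (Rn n) := Ω \ closure A

/-- The standing geometric assumptions: `Ω` is a bounded Lipschitz domain; `A` is a (possibly empty)
open set with Lipschitz boundary and finitely many connected components, compactly contained
in `Ω`; and `B = Ω \ closure A` is a domain. -/
structure IsTwoPhaseDomain {n : ℕ} (Ω A : Set (Rn n)) : Prop where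
  isOpen_Ω : IsOpen Ω
  isConnected_Ω : IsConnected Ω
  isBounded_Ω : Bornology.IsBounded Ω
  lipschitz_Ω : HasLipschitzBoundary Ω
  isOpen_A : IsOpen A
  lipschitz_A : HasLipschitzBoundary A
  finite_components_A : Finite (ConnectedComponents A)
  closure_A_subset : closure A ⊆ Ω
  isConnected_B : IsConnected (outer Ω A)

/-! ### Sobolev spaces -/

/-- `G` is a weak (distributional) gradient of `u` on the open set `U`. -/
def HasWeakGrad {n : ℕ} (U : Set (Rn n)) (u : Rn n → ℝ) (G : Rn n → Rn n) : Prop :=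
  LocallyIntegrableOn u U ∧ LocallyIntegrableOn G U ∧
    ∀ ψ : Rn n → ℝ, ContDiff ℝ ∞ ψ → HasCompactSupport ψ → tsupport ψ ⊆ U →
      ∫ x in U, u x • gradient ψ x = -∫ x in U, ψ x • G x

open Classical in
/-- The weak gradient `∇u` on `U`, which is unique up to a null set (`0` if there is none). -/
def weakGrad {n : ℕ} (U : Set (Rn n)) (u : Rn n → ℝ) : Rn n → Rn n :=
  if h : ∃ G, HasWeakGrad U u G then h.choose else 0

/-- `u ∈ W^{1,p}(U)`. The values of `u` outside `U` play no role. -/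
def MemW1p {n : ℕ} (p : ℝ) (U : Set (Rn n)) (u : Rn n → ℝ) : Prop :=
  MemLp u (ENNReal.ofReal p) (volume.restrict U) ∧
    ∃ G, HasWeakGrad U u G ∧ MemLp G (ENNReal.ofReal p) (volume.restrict U)

/-- For an open `U ⊆ Ω`: the function `w ∈ W^{1,p}(U)` vanishes on `∂Ω`, that is, `w` lies in the
closure in `W^{1,p}(U)` of the restrictions to `U` of the functions in `C¹_c(Ω)`. -/
def VanishesOnBdry {n : ℕ} (p : ℝ) (Ω U : Set (Rn n)) (w : Rn n → ℝ) : Prop :=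
  MemW1p p U w ∧ ∀ δ : ℝ≥0∞, 0 < δ → ∃ ψ : Rn n → ℝ,
    ContDiff ℝ 1 ψ ∧ HasCompactSupport ψ ∧ tsupport ψ ⊆ Ω ∧
      eLpNorm (fun x => w x - ψ x) (ENNReal.ofReal p) (volume.restrict U) +
        eLpNorm (fun x => weakGrad U w x - gradient ψ x) (ENNReal.ofReal p)
          (volume.restrict U) < δ

/-- `w ∈ W₀^{1,p}(Ω)`, the closure of `C¹_c(Ω)` in `W^{1,p}(Ω)`. -/
def MemW01p {n : ℕ} (p : ℝ) (Ω : Set (Rn n)) (w : Rn n → ℝ) : Prop :=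
  VanishesOnBdry p Ω Ω w

/-! ### Assumptions on the conductivity `σ(x, E)` in a region `U` -/

/-- Carathéodory condition on `U`. Continuity in `E` is only asked on `(0, ∞)`, since for a growth
exponent `p < 2` the conductivity blows up as `E → 0`; the value `σ(x, 0)` is never used. -/
def IsCaratheodory {n : ℕ} (U : Set (Rn n)) (σ : Rn n → ℝ → ℝ) : Prop :=
  (∀ E : ℝ, 0 < E → AEMeasurable (fun x => σ x E) (volume.restrict U)) ∧
    ∀ᵐ x ∂(volume.restrict U), ContinuousOn (σ x) (Ioi 0)

/-- Two-sided growth condition of exponent `p` in `U`. -/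
def HasGrowth {n : ℕ} (p : ℝ) (U : Set (Rn n)) (σ : Rn n → ℝ → ℝ) : Prop :=
  ∃ σlo σhi E₀ : ℝ, 0 < σlo ∧ σlo ≤ σhi ∧ 0 < E₀ ∧
    ∀ᵐ x ∂(volume.restrict U), ∀ E : ℝ, 0 < E →
      σlo * (E / E₀) ^ (p - 2) ≤ σ x E ∧
        (2 ≤ p → σ x E ≤ σhi * (1 + (E / E₀) ^ (p - 2))) ∧
        (p < 2 → σ x E ≤ σhi * (E / E₀) ^ (p - 2))

/-- Strong monotonicity of exponent `p` in `U`. -/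
def IsStronglyMonotone {n : ℕ} (p : ℝ) (U : Set (Rn n)) (σ : Rn n → ℝ → ℝ) : Prop :=
  ∃ κ : ℝ, 0 < κ ∧ ∀ᵐ x ∂(volume.restrict U), ∀ E₁ E₂ : Rn n,
    (2 ≤ p → κ * ‖E₂ - E₁‖ ^ p ≤
      inner ℝ (σ x ‖E₂‖ • E₂ - σ x ‖E₁‖ • E₁) (E₂ - E₁)) ∧
    (p < 2 → κ * (1 + ‖E₂‖ ^ 2 + ‖E₁‖ ^ 2) ^ ((p - 2) / 2) * ‖E₂ - E₁‖ ^ 2 ≤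
      inner ℝ (σ x ‖E₂‖ • E₂ - σ x ‖E₁‖ • E₁) (E₂ - E₁))

/-! ### Dirichlet energies and minimum problems -/

/-- The Dirichlet energy density `Q(x, E) = ∫₀ᴱ σ(x, ξ) ξ dξ`. -/
def energyDensity {n : ℕ} (σ : Rn n → ℝ → ℝ) (x : Rn n) (E : ℝ) : ℝ :=
  ∫ ξ in (0 : ℝ)..E, σ x ξ * ξ

/-- The energy `∫_U Q(x, |G(x)|) dx ∈ [0, ∞]` of a field `G` in the region `U`. -/
def energy {n : ℕ} (σ : Rn n → ℝ → ℝ) (U : Set (Rn n)) (G : Rn n → Rn n) : ℝ≥0∞ :=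
  ∫⁻ x in U, ENNReal.ofReal (energyDensity σ x ‖G x‖)

/-- `u` minimizes `J` among the functions satisfying `adm`. -/
def IsMinimizer {n : ℕ} (adm : (Rn n → ℝ) → Prop) (J : (Rn n → ℝ) → ℝ≥0∞)
    (u : Rn n → ℝ) : Prop :=
  adm u ∧ ∀ v, adm v → J u ≤ J v

/-- One material (`A = ∅`): minimize `∫_Ω Q(x, |∇u|)` among `u ∈ W^{1,p}(Ω)` with `u = g`
on `∂Ω`. -/
def IsSinglePhaseSolution {n : ℕ} (p : ℝ) (Ω : Set (Rn n)) (σ : Rn n → ℝ → ℝ)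
    (g u : Rn n → ℝ) : Prop :=
  IsMinimizer (fun v => MemW1p p Ω v ∧ MemW01p p Ω (fun x => v x - g x))
    (fun v => energy σ Ω (weakGrad Ω v)) u

/-- Two materials: minimize `∫_B Q(x, |∇u|) + ∫_A Q(x, |∇u|)` among
`u ∈ W^{1,p}(Ω) ∪ W^{1,q}(Ω) = W^{1,min(p,q)}(Ω)` with `u = g` on `∂Ω`, that is,
`u - g ∈ W₀^{1,p}(Ω) ∪ W₀^{1,q}(Ω) = W₀^{1,min(p,q)}(Ω)`. -/
def IsTwoPhaseSolution {n : ℕ} (p q : ℝ) (Ω A : Set (Rn n)) (σ : Rn n → ℝ → ℝ)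
    (g u : Rn n → ℝ) : Prop :=
  IsMinimizer
    (fun v => MemW1p (min p q) Ω v ∧ MemW01p (min p q) Ω (fun x => v x - g x))
    (fun v => energy σ (outer Ω A) (weakGrad Ω v) + energy σ A (weakGrad Ω v)) u

/-- Perfect electric insulator in `A`: minimize `∫_B Q(x, |∇u|)` among `u ∈ W^{1,p}(B)` with
`u = g` on `∂Ω` (no condition on `∂A`). -/
def IsPEISolution {n : ℕ} (p : ℝ) (Ω A : Set (Rn n)) (σ : Rn n → ℝ → ℝ)
    (g u : Rn n → ℝ) : Prop :=
  IsMinimizer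
    (fun v => MemW1p p (outer Ω A) v ∧ VanishesOnBdry p Ω (outer Ω A) (fun x => v x - g x))
    (fun v => energy σ (outer Ω A) (weakGrad (outer Ω A) v)) u

/-- Perfect electric conductor in `A`: minimize `∫_B Q(x, |∇u|)` among `u ∈ W^{1,p}(Ω)` with
`u = g` on `∂Ω` and `∇u = 0` a.e. in `A`. -/
def IsPECSolution {n : ℕ} (p : ℝ) (Ω A : Set (Rn n)) (σ : Rn n → ℝ → ℝ)
    (g u : Rn n → ℝ) : Prop :=
  IsMinimizer
    (fun v => MemW1p p Ω v ∧ MemW01p p Ω (fun x => v x - g x) ∧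
      ∀ᵐ x ∂(volume.restrict A), weakGrad Ω v x = 0)
    (fun v => energy σ (outer Ω A) (weakGrad Ω v)) u

/-- `G ε → G₀` in `L^p(U)` as `ε → 0⁺`, all these fields (for `ε > 0`) being elements
of `L^p(U)`. -/
def ConvergesInLp {n : ℕ} (p : ℝ) (U : Set (Rn n)) (G : ℝ → Rn n → Rn n)
    (G₀ : Rn n → Rn n) : Prop :=
  MemLp G₀ (ENNReal.ofReal p) (volume.restrict U) ∧
    (∀ ε : ℝ, 0 < ε → MemLp (G ε) (ENNReal.ofReal p) (volume.restrict U)) ∧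
    Tendsto (fun ε => eLpNorm (fun x => G ε x - G₀ x) (ENNReal.ofReal p) (volume.restrict U))
      (𝓝[>] 0) (𝓝 0)

end

end PiecewiseNonlinear

/-! The argument is the direct one for uniformly convex energies. Put W(x, X) = Q(x, |X|). Along a
line the derivative of W is the flux σ(x, |X|)X tested against the direction, so monotonicity of the
flux makes W convex, and strong monotonicity gives a modulus: for every δ, |X - Y|^p is at most δ(1
+ |X|^p + |Y|^p) plus K(δ) times the midpoint defect W(X) + W(Y) - 2W((X + Y)/2)
(`exists_uniform_convexity`). Growth makes W comparable to |X|^p up to an additive constant from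
above.

Let G₀ and G_ε be the gradients of the minimizers for data f and f + εφ, let Φ be the gradient of an
admissible direction and J the total energy. The field Y_ε = G₀ + εΦ is admissible for the perturbed
datum, and so is its midpoint with G_ε, while G_ε - εΦ is admissible for f. Minimality at the
midpoint bounds the defect of the pair (G_ε, Y_ε) by J(Y_ε) - J(G_ε). Convexity gives J(Y_ε) ≤ J(G₀)
+ O(ε). Minimality of G₀ against G_ε - εΦ, with convexity again, gives J(G₀) ≤ J(G_ε) + O(ε). Hence
the defect is O(ε), G_ε - Y_ε tends to 0 in L^p, and Y_ε tends to G₀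
(`convergesInLp_of_minimality`). No Euler-Lagrange equation is needed.

All four problems fit this scheme, with two adjustments. In the two-phase problem the infimum must
first be shown finite: `exists_finite_energy` uses f - χf, where χ is a cutoff equal to 1 on the
closure of A. That χf has zero boundary values is proved by mollification. For the perfect
conductor, φ may have nonzero gradient in A, so the direction is the difference of two solutions
instead. Convergence in L^r(Ω) also uses that a Lipschitz boundary is a null set. -/

namespace PiecewiseNonlinear

noncomputable section


/-! ### Pointwise analysis of the energy density -/

/-- The structural assumptions on the conductivity at a single point. -/
structure IsConductivity (n : ℕ) (p lo hi E₀ κ : ℝ) (s : ℝ → ℝ) : Prop where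
  cont : ContinuousOn s (Ioi 0)
  lower : ∀ E : ℝ, 0 < E → lo * (E / E₀) ^ (p - 2) ≤ s E
  upper_ge : ∀ E : ℝ, 0 < E → 2 ≤ p → s E ≤ hi * (1 + (E / E₀) ^ (p - 2))
  upper_lt : ∀ E : ℝ, 0 < E → p < 2 → s E ≤ hi * (E / E₀) ^ (p - 2)
  mono_ge : ∀ E₁ E₂ : Rn n, 2 ≤ p → κ * ‖E₂ - E₁‖ ^ p ≤
      inner ℝ (s ‖E₂‖ • E₂ - s ‖E₁‖ • E₁) (E₂ - E₁)
  mono_lt : ∀ E₁ E₂ : Rn n, p < 2 →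
      κ * (1 + ‖E₂‖ ^ 2 + ‖E₁‖ ^ 2) ^ ((p - 2) / 2) * ‖E₂ - E₁‖ ^ 2 ≤
      inner ℝ (s ‖E₂‖ • E₂ - s ‖E₁‖ • E₁) (E₂ - E₁)

/-- The scalar flux `ξ ↦ s(ξ) ξ`, extended by zero to `ξ ≤ 0`. -/
def flux (s : ℝ → ℝ) (ξ : ℝ) : ℝ := if 0 < ξ then s ξ * ξ else 0

/-- The primitive of the flux that vanishes at zero. -/
def fluxPrimitive (s : ℝ → ℝ) (E : ℝ) : ℝ := ∫ ξ in (0 : ℝ)..E, flux s ξ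

/-- Only ξ in (0, E] contributes. Nothing is assumed about σ(x, ξ) for ξ < 0, whereas the flux will
be continuous on the whole line, which the calculus below requires. -/
lemma energyDensity_eq_fluxPrimitive {n : ℕ} (σ : Rn n → ℝ → ℝ) (x : Rn n) {E : ℝ} (hE : 0 ≤ E) :
    energyDensity σ x E = fluxPrimitive (σ x) E := by
  unfold energyDensity fluxPrimitive
  refine intervalIntegral.integral_congr_ae (Eventually.of_forall fun ξ hξ => ?_)
  rw [uIoc_of_le hE] at hξ
  simp [flux, hξ.1]

lemma mul_div_rpow_sub_two {E E₀ : ℝ} (hE : 0 < E) (hE₀ : 0 < E₀) (p : ℝ) :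
    (E / E₀) ^ (p - 2) * E = E₀ * (E / E₀) ^ (p - 1) := by
  have h : 0 < E / E₀ := by positivity
  have : (E / E₀) ^ (p - 1) = (E / E₀) ^ (p - 2) * (E / E₀) := by
    rw [← Real.rpow_add_one h.ne']; congr 1; ring
  rw [this]; field_simp

namespace IsConductivity

variable {n : ℕ} {p lo hi E₀ κ : ℝ} {s : ℝ → ℝ}

lemma flux_le (h : IsConductivity n p lo hi E₀ κ s) (hhi : 0 < hi) (hE₀ : 0 < E₀) {E : ℝ}
    (hE : 0 < E) : flux s E ≤ hi * (E + E₀ * (E / E₀) ^ (p - 1)) := by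
  have h1 : s E ≤ hi * (1 + (E / E₀) ^ (p - 2)) := by
    rcases le_or_gt 2 p with hp | hp
    · exact h.upper_ge E hE hp
    · refine (h.upper_lt E hE hp).trans ?_
      gcongr; linarith
  rw [flux, if_pos hE]
  calc s E * E ≤ hi * (1 + (E / E₀) ^ (p - 2)) * E := by gcongr
    _ = hi * (E + (E / E₀) ^ (p - 2) * E) := by ring
    _ = _ := by rw [mul_div_rpow_sub_two hE hE₀]

lemma le_flux (h : IsConductivity n p lo hi E₀ κ s) (hE₀ : 0 < E₀) {E : ℝ}
    (hE : 0 < E) : lo * (E₀ * (E / E₀) ^ (p - 1)) ≤ flux s E := by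
  rw [flux, if_pos hE, ← mul_div_rpow_sub_two hE hE₀, ← mul_assoc]
  gcongr
  exact h.lower E hE

lemma flux_nonneg (h : IsConductivity n p lo hi E₀ κ s) (hlo : 0 < lo) (hE₀ : 0 < E₀) (E : ℝ) :
    0 ≤ flux s E := by
  rcases le_or_gt E 0 with hE | hE
  · simp [flux, hE.not_gt]
  · exact le_trans (by positivity) (h.le_flux hE₀ hE)

/-- The only delicate point is 0, where s itself may blow up when p < 2. The growth bound is of
order E + E^(p-1), and p > 1 squeezes the flux to 0. -/
lemma continuous_flux (h : IsConductivity n p lo hi E₀ κ s) (hp : 1 < p) (hlo : 0 < lo)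
    (hhi : 0 < hi) (hE₀ : 0 < E₀) : Continuous (flux s) := by
  rw [continuous_iff_continuousAt]
  intro E
  rcases lt_trichotomy E 0 with hE | rfl | hE
  · refine (continuousAt_const (y := (0 : ℝ))).congr ?_
    filter_upwards [Iio_mem_nhds hE] with y hy
    simp [flux, (le_of_lt (mem_Iio.1 hy)).not_gt]
  · have h0 : flux s 0 = 0 := by simp [flux]
    rw [ContinuousAt, h0]
    have hlim : Tendsto (fun E : ℝ => hi * (|E| + E₀ * (|E| / E₀) ^ (p - 1))) (𝓝 0) (𝓝 0) := by
      have hc : Continuous (fun E : ℝ => hi * (|E| + E₀ * (|E| / E₀) ^ (p - 1))) := by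
        have : Continuous (fun E : ℝ => (|E| / E₀) ^ (p - 1)) :=
          (by fun_prop : Continuous fun E : ℝ => |E| / E₀).rpow_const
            (fun _ => Or.inr (by linarith))
        fun_prop
      have := hc.tendsto 0
      simpa [Real.zero_rpow (by linarith : p - 1 ≠ 0)] using this
    refine tendsto_of_tendsto_of_tendsto_of_le_of_le tendsto_const_nhds hlim
      (fun E => h.flux_nonneg hlo hE₀ E) (fun E => ?_)
    rcases le_or_gt E 0 with hE | hE
    · simp only [flux, hE.not_gt, if_false]; positivity
    · simpa [abs_of_pos hE] using h.flux_le hhi hE₀ hE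
  · have : ContinuousAt (fun ξ => s ξ * ξ) E :=
      (h.cont.continuousAt (Ioi_mem_nhds hE)).mul continuousAt_id
    refine this.congr ?_
    filter_upwards [Ioi_mem_nhds hE] with y hy
    simp [flux, mem_Ioi.1 hy]

lemma fluxPrimitive_nonneg (h : IsConductivity n p lo hi E₀ κ s) (hlo : 0 < lo) (hE₀ : 0 < E₀)
    {E : ℝ} (hE : 0 ≤ E) : 0 ≤ fluxPrimitive s E :=
  intervalIntegral.integral_nonneg hE fun ξ _ => h.flux_nonneg hlo hE₀ ξ

lemma fluxPrimitive_le (h : IsConductivity n p lo hi E₀ κ s) (hp : 1 < p) (hlo : 0 < lo)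
    (hhi : 0 < hi) (hE₀ : 0 < E₀) {E : ℝ} (hE : 0 ≤ E) :
    fluxPrimitive s E ≤ hi * (1 + E₀ ^ 2 * (E₀ ^ p)⁻¹) * (1 + E ^ p) := by
  rcases hE.eq_or_lt with rfl | hE
  · simp only [fluxPrimitive, intervalIntegral.integral_same]; positivity
  have hc := h.continuous_flux hp hlo hhi hE₀
  have hbd : ∀ b : ℝ, (∀ ξ ∈ Icc 0 E, flux s ξ ≤ b) → fluxPrimitive s E ≤ E * b := by
    intro b hb
    have := intervalIntegral.integral_mono_on hE.le (hc.intervalIntegrable 0 E)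
      (continuous_const.intervalIntegrable (μ := volume) 0 E) hb
    simpa [fluxPrimitive] using this
  have hid : E * (E₀ * (E / E₀) ^ (p - 1)) = E₀ ^ 2 * (E₀ ^ p)⁻¹ * E ^ p := by
    rw [Real.rpow_sub_one (by positivity), Real.div_rpow hE.le hE₀.le]
    field_simp
  have hEp : 0 ≤ E ^ p := by positivity
  have hA : 0 ≤ E₀ ^ 2 * (E₀ ^ p)⁻¹ := by positivity
  rcases le_or_gt 2 p with hp2 | hp2
  · refine (hbd (hi * (E + E₀ * (E / E₀) ^ (p - 1))) fun ξ hξ => ?_).trans ?_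
    · rcases hξ.1.eq_or_lt with h0 | h0
      · rw [← h0]; simp only [flux, lt_irrefl, if_false]; positivity
      · refine (h.flux_le hhi hE₀ h0).trans ?_
        have := hξ.2
        gcongr
    · have hsq : E * E ≤ 1 + E ^ p := by
        rcases le_or_gt E 1 with h1 | h1
        · nlinarith
        · have : E ^ (2 : ℝ) ≤ E ^ p := Real.rpow_le_rpow_of_exponent_le h1.le hp2
          rw [Real.rpow_two] at this; nlinarith
      have : E * (hi * (E + E₀ * (E / E₀) ^ (p - 1)))
        = hi * (E * E + E * (E₀ * (E / E₀) ^ (p - 1))) := by ring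
      rw [this, hid, mul_assoc hi]
      refine mul_le_mul_of_nonneg_left ?_ hhi.le
      nlinarith
  -- For p < 2 the linear term in `flux_le` would produce E², which is not dominated by 1 + E^p, so
  -- the sharper bound `upper_lt` is used.
  · refine (hbd (hi * (E₀ * (E / E₀) ^ (p - 1))) fun ξ hξ => ?_).trans ?_
    · rcases hξ.1.eq_or_lt with h0 | h0
      · rw [← h0]; simp only [flux, lt_irrefl, if_false]; positivity
      · rw [flux, if_pos h0]
        calc s ξ * ξ ≤ hi * (ξ / E₀) ^ (p - 2) * ξ := by
              gcongr; exact h.upper_lt ξ h0 hp2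
          _ = hi * (E₀ * (ξ / E₀) ^ (p - 1)) := by
              rw [mul_assoc, mul_div_rpow_sub_two h0 hE₀]
          _ ≤ _ := by
            have := hξ.2
            gcongr
    · have : E * (hi * (E₀ * (E / E₀) ^ (p - 1)))
        = hi * (E * (E₀ * (E / E₀) ^ (p - 1))) := by ring
      rw [this, hid, mul_assoc hi]
      refine mul_le_mul_of_nonneg_left ?_ hhi.le
      nlinarith

/-- The part of the integral over [0, E/2] is discarded. On [E/2, E] the lower bound for the flux is
increasing, hence at least its value at E/2; this is the origin of the factor (2E₀)^p. -/
lemma le_fluxPrimitive (h : IsConductivity n p lo hi E₀ κ s) (hp : 1 < p) (hlo : 0 < lo)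
    (hhi : 0 < hi) (hE₀ : 0 < E₀) {E : ℝ} (hE : 0 ≤ E) :
    lo * E₀ ^ 2 * ((2 * E₀) ^ p)⁻¹ * E ^ p ≤ fluxPrimitive s E := by
  rcases hE.eq_or_lt with rfl | hE
  · simp [fluxPrimitive, Real.zero_rpow (by linarith : p ≠ 0)]
  have hc := h.continuous_flux hp hlo hhi hE₀
  have h1 : (E / 2) * (lo * (E₀ * (E / 2 / E₀) ^ (p - 1))) ≤ ∫ ξ in (E / 2)..E, flux s ξ := by
    have := intervalIntegral.integral_mono_on (a := E / 2) (b := E) (by linarith)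
      (continuous_const.intervalIntegrable (μ := volume) _ _) (hc.intervalIntegrable (E / 2) E)
      (f := fun _ => lo * (E₀ * (E / 2 / E₀) ^ (p - 1))) (fun ξ hξ => ?_)
    · rw [intervalIntegral.integral_const, smul_eq_mul] at this
      calc _ = (E - E / 2) * (lo * (E₀ * (E / 2 / E₀) ^ (p - 1))) := by ring
        _ ≤ _ := this
    · have h0 : 0 < ξ := by linarith [hξ.1]
      refine le_trans ?_ (h.le_flux hE₀ h0)
      have := hξ.1
      gcongr
  have h2 : fluxPrimitive s E = (∫ ξ in (0 : ℝ)..(E / 2), flux s ξ) + ∫ ξ in (E / 2)..E, flux s ξ :=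
    (intervalIntegral.integral_add_adjacent_intervals (hc.intervalIntegrable _ _)
      (hc.intervalIntegrable _ _)).symm
  have h3 : 0 ≤ ∫ ξ in (0 : ℝ)..(E / 2), flux s ξ :=
    h.fluxPrimitive_nonneg hlo hE₀ (E := E / 2) (by linarith)
  have hid : (E / 2) * (lo * (E₀ * (E / 2 / E₀) ^ (p - 1))) =
      lo * E₀ ^ 2 * ((2 * E₀) ^ p)⁻¹ * E ^ p := by
    rw [Real.rpow_sub_one (by positivity), div_div, Real.div_rpow hE.le (by positivity)]
    field_simp
  linarith

lemma hasDerivAt_fluxPrimitive (h : IsConductivity n p lo hi E₀ κ s) (hp : 1 < p) (hlo : 0 < lo)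
    (hhi : 0 < hi) (hE₀ : 0 < E₀) (E : ℝ) : HasDerivAt (fluxPrimitive s) (flux s E) E :=
  intervalIntegral.integral_hasDerivAt_right
    ((h.continuous_flux hp hlo hhi hE₀).intervalIntegrable _ _)
    ((h.continuous_flux hp hlo hhi hE₀).stronglyMeasurableAtFilter _ _)
    (h.continuous_flux hp hlo hhi hE₀).continuousAt

lemma hasDerivAt_line (h : IsConductivity n p lo hi E₀ κ s) (hp : 1 < p) (hlo : 0 < lo)
    (hhi : 0 < hi) (hE₀ : 0 < E₀) (M v : Rn n) (t : ℝ) :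
    HasDerivAt (fun τ : ℝ => fluxPrimitive s ‖M + τ • v‖)
      (inner ℝ (s ‖M + t • v‖ • (M + t • v)) v) t := by
  have hl : HasDerivAt (fun τ : ℝ => M + τ • v) v t := by
    simpa using ((hasDerivAt_id t).smul_const v).const_add M
  -- The norm is not differentiable where the line meets 0. There the primitive has zero derivative,
  -- so its composition with the norm is still Fréchet differentiable, with derivative 0.
  by_cases hN : M + t • v = 0
  · have hP : HasDerivAt (fluxPrimitive s) 0 0 := by
      simpa [flux] using h.hasDerivAt_fluxPrimitive hp hlo hhi hE₀ 0
    have hF : HasFDerivAt (fun X : Rn n => fluxPrimitive s ‖X‖) (0 : Rn n →L[ℝ] ℝ) 0 := by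
      rw [hasFDerivAt_iff_isLittleO_nhds_zero]
      rw [hasDerivAt_iff_isLittleO_nhds_zero] at hP
      have := hP.comp_tendsto (k := fun X : Rn n => ‖X‖) (l' := 𝓝 0) (by
        simpa using (continuous_norm (E := Rn n)).tendsto 0)
      simpa [Function.comp_def] using this.trans_isBigO (Asymptotics.isBigO_refl _ _).norm_left
    rw [← hN] at hF
    have := hF.comp_hasDerivAt t hl
    simpa [hN, Function.comp_def] using this
  · have hn : 0 < ‖M + t • v‖ := norm_pos_iff.2 hN
    have h1 : HasDerivAt (fun τ : ℝ => ‖M + τ • v‖) (inner ℝ (M + t • v) v / ‖M + t • v‖) t := by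
      have := (hl.norm_sq).sqrt (by positivity)
      simp only [Real.sqrt_sq (norm_nonneg _)] at this
      convert this using 1
      field_simp
    have := (h.hasDerivAt_fluxPrimitive hp hlo hhi hE₀ ‖M + t • v‖).comp t h1
    have e : flux s ‖M + t • v‖ * (inner ℝ (M + t • v) v / ‖M + t • v‖) =
        inner ℝ (s ‖M + t • v‖ • (M + t • v)) v := by
      rw [show flux s ‖M + t • v‖ = s ‖M + t • v‖ * ‖M + t • v‖ from if_pos hn,
        real_inner_smul_left]
      field_simp
    rwa [e] at this

lemma inner_nonneg (h : IsConductivity n p lo hi E₀ κ s) (hκ : 0 < κ) (E₁ E₂ : Rn n) :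
    0 ≤ inner ℝ (s ‖E₂‖ • E₂ - s ‖E₁‖ • E₁) (E₂ - E₁) := by
  rcases le_or_gt 2 p with hp2 | hp2
  · exact le_trans (by positivity) (h.mono_ge E₁ E₂ hp2)
  · exact le_trans (by positivity) (h.mono_lt E₁ E₂ hp2)

/-- On a line, the derivative is the flux paired with the direction, and monotonicity of the vector
field says exactly that it is nondecreasing. -/
lemma fluxPrimitive_convex (h : IsConductivity n p lo hi E₀ κ s) (hp : 1 < p) (hlo : 0 < lo)
    (hhi : 0 < hi) (hE₀ : 0 < E₀) (hκ : 0 < κ) (X v : Rn n) {t : ℝ} (ht : 0 ≤ t) (ht1 : t ≤ 1) :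
    fluxPrimitive s ‖X + t • v‖ ≤
      (1 - t) * fluxPrimitive s ‖X‖ + t * fluxPrimitive s ‖X + v‖ := by
  have hd := h.hasDerivAt_line hp hlo hhi hE₀ X v
  have hconv : ConvexOn ℝ univ (fun τ : ℝ => fluxPrimitive s ‖X + τ • v‖) := by
    refine Monotone.convexOn_univ_of_deriv (fun τ => (hd τ).differentiableAt) ?_
    intro a b hab
    rw [(hd a).deriv, (hd b).deriv]
    rcases hab.eq_or_lt with rfl | hab
    · exact le_rfl
    have := h.inner_nonneg hκ (X + a • v) (X + b • v)
    have hdiff : X + b • v - (X + a • v) = (b - a) • v := by module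
    rw [hdiff, real_inner_smul_right, inner_sub_left] at this
    have := nonneg_of_mul_nonneg_right this (by linarith)
    linarith
  have := hconv.2 (mem_univ 0) (mem_univ 1) (by linarith : 0 ≤ 1 - t) ht (by ring)
  simpa using this

/-- The second symmetric difference of the energy, bounded below through its derivative. -/
lemma le_second_difference (h : IsConductivity n p lo hi E₀ κ s) (hp : 1 < p) (hlo : 0 < lo)
    (hhi : 0 < hi) (hE₀ : 0 < E₀) (M v : Rn n) {c m : ℝ} (hm : 1 < m)
    (hc : ∀ t ∈ Ioo (0 : ℝ) 1, 2 * t * (c * (m * t ^ (m - 1))) ≤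
      inner ℝ (s ‖M + t • v‖ • (M + t • v) - s ‖M + (-t) • v‖ • (M + (-t) • v))
        ((M + t • v) - (M + (-t) • v))) :
    c ≤ fluxPrimitive s ‖M + v‖ + fluxPrimitive s ‖M - v‖ - 2 * fluxPrimitive s ‖M‖ := by
  have hd := h.hasDerivAt_line hp hlo hhi hE₀ M v
  -- The function F(τ) + F(-τ) - cτ^m is nondecreasing on [0, 1], where F is the energy along the
  -- line. Comparing its values at 0 and 1 gives the claim. The factor 2t in `hc` is the length in
  -- units of v between the two evaluation points.
  have hk : ∀ t : ℝ, HasDerivAt (fun τ : ℝ => fluxPrimitive s ‖M + τ • v‖ +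
      fluxPrimitive s ‖M + (-τ) • v‖ - c * τ ^ m)
      (inner ℝ (s ‖M + t • v‖ • (M + t • v)) v +
        inner ℝ (s ‖M + (-t) • v‖ • (M + (-t) • v)) v * (-1) - c * (m * t ^ (m - 1))) t := by
    intro t
    exact ((hd t).add ((hd (-t)).comp t (hasDerivAt_neg t))).sub
      ((Real.hasDerivAt_rpow_const (Or.inr hm.le)).const_mul c)
  have hmono : MonotoneOn (fun τ : ℝ => fluxPrimitive s ‖M + τ • v‖ +
      fluxPrimitive s ‖M + (-τ) • v‖ - c * τ ^ m) (Icc 0 1) := by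
    refine monotoneOn_of_deriv_nonneg (convex_Icc 0 1)
      (fun t _ => (hk t).continuousAt.continuousWithinAt)
      (fun t _ => (hk t).differentiableAt.differentiableWithinAt) (fun t ht => ?_)
    rw [interior_Icc] at ht
    rw [(hk t).deriv]
    have h1 := hc t ht
    have hdiff : M + t • v - (M + (-t) • v) = (2 * t) • v := by module
    rw [hdiff, real_inner_smul_right, inner_sub_left] at h1
    have := le_of_mul_le_mul_left h1 (by linarith [ht.1])
    linarith
  have := hmono (left_mem_Icc.2 zero_le_one) (right_mem_Icc.2 zero_le_one) zero_le_one
  simp only [zero_smul, add_zero, neg_zero, one_smul, Real.one_rpow,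
    Real.zero_rpow (by linarith : m ≠ 0), neg_smul, ← sub_eq_add_neg, mul_zero, mul_one,
    sub_zero] at this
  linarith

end IsConductivity

/-- For p < 2 strong monotonicity controls only d² with the degenerate weight w^((p-2)/2). Splitting
at d = η√w recovers d^p: small d costs a small multiple of w^(p/2), large d is absorbed by the
weighted square. -/
lemma rpow_le_add_of_weight {p η w d : ℝ} (hp2 : p < 2) (hη : 0 < η) (hp : 1 < p) (hw : 0 < w)
    (hd : 0 ≤ d) : d ^ p ≤ η ^ p * w ^ (p / 2) + η ^ (p - 2) * (w ^ ((p - 2) / 2) * d ^ 2) := by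
  have hsq : ∀ a : ℝ, √w ^ a = w ^ (a / 2) := fun a => by
    rw [Real.sqrt_eq_rpow, ← Real.rpow_mul hw.le]; ring_nf
  have hsw : 0 < √w := Real.sqrt_pos.2 hw
  rcases le_or_gt d (η * √w) with h | h
  · have : d ^ p ≤ (η * √w) ^ p := Real.rpow_le_rpow hd h (by linarith)
    rw [Real.mul_rpow hη.le hsw.le, hsq] at this
    have h2 : 0 ≤ η ^ (p - 2) * (w ^ ((p - 2) / 2) * d ^ 2) := by positivity
    linarith
  · have hd0 : 0 < d := lt_trans (by positivity) h
    have h1 : d ^ (p - 2) ≤ (η * √w) ^ (p - 2) :=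
      Real.rpow_le_rpow_of_nonpos (by positivity) h.le (by linarith)
    rw [Real.mul_rpow hη.le hsw.le, hsq] at h1
    have h2 : d ^ p = d ^ (p - 2) * d ^ 2 := by
      rw [← Real.rpow_two, ← Real.rpow_add hd0]; ring_nf
    have h3 : 0 ≤ η ^ p * w ^ (p / 2) := by positivity
    have h4 : d ^ (p - 2) * d ^ 2 ≤ η ^ (p - 2) * w ^ ((p - 2) / 2) * d ^ 2 := by gcongr
    rw [h2]; linarith

/-- Quantitative uniform convexity of the energy density. -/
lemma exists_uniform_convexity (n : ℕ) {p lo hi E₀ κ : ℝ} (hp : 1 < p) (hlo : 0 < lo)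
    (hhi : 0 < hi) (hE₀ : 0 < E₀) (hκ : 0 < κ) {δ : ℝ} (hδ : 0 < δ) :
    ∃ K : ℝ, 0 ≤ K ∧ ∀ s, IsConductivity n p lo hi E₀ κ s → ∀ X Y : Rn n,
      ‖X - Y‖ ^ p ≤ δ * (1 + ‖X‖ ^ p + ‖Y‖ ^ p) +
        K * (fluxPrimitive s ‖X‖ + fluxPrimitive s ‖Y‖ -
          2 * fluxPrimitive s ‖(1 / 2 : ℝ) • (X + Y)‖) := by
  rcases le_or_gt 2 p with hp2 | hp2
  -- With c = κ|X - Y|^p/(2p) and m = p the required derivative bound is exactly strong monotonicity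
  -- at the points of the segment; the δ term is not needed.
  · refine ⟨2 * p / κ, by positivity, fun s h X Y => ?_⟩
    have key := h.le_second_difference hp hlo hhi hE₀ ((1 / 2 : ℝ) • (X + Y))
      ((1 / 2 : ℝ) • (X - Y)) (c := κ / (2 * p) * ‖X - Y‖ ^ p) (m := p) hp (fun t ht => ?_)
    · have e1 : (1 / 2 : ℝ) • (X + Y) + (1 / 2 : ℝ) • (X - Y) = X := by module
      have e2 : (1 / 2 : ℝ) • (X + Y) - (1 / 2 : ℝ) • (X - Y) = Y := by module
      rw [e1, e2] at key
      have hd : 0 ≤ δ * (1 + ‖X‖ ^ p + ‖Y‖ ^ p) := by positivity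
      have h2 : ‖X - Y‖ ^ p = 2 * p / κ * (κ / (2 * p) * ‖X - Y‖ ^ p) := by field_simp
      have h3 := mul_le_mul_of_nonneg_left key (by positivity : 0 ≤ 2 * p / κ)
      linarith
    · refine le_trans (le_of_eq ?_) (h.mono_ge _ _ hp2)
      have : (1 / 2 : ℝ) • (X + Y) + t • (1 / 2 : ℝ) • (X - Y) -
        ((1 / 2 : ℝ) • (X + Y) + (-t) • (1 / 2 : ℝ) • (X - Y)) = t • (X - Y) := by module
      rw [this, norm_smul, Real.norm_of_nonneg ht.1.le, Real.mul_rpow ht.1.le (norm_nonneg _),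
        Real.rpow_sub_one ht.1.ne']
      have := ht.1.ne'
      field_simp
  -- Here η = δ^(1/p), so that η^p = δ. The second difference is bounded below by c = κ
  -- w^((p-2)/2)|X - Y|²/4 with m = 2, and K = 4η^(p-2)/κ turns c into the second term of
  -- `rpow_le_add_of_weight`.
  · refine ⟨4 * (δ ^ (1 / p)) ^ (p - 2) / κ, by positivity, fun s h X Y => ?_⟩
    set w : ℝ := 1 + ‖X‖ ^ 2 + ‖Y‖ ^ 2 with hw
    have hw0 : 0 < w := by positivity
    have key := h.le_second_difference hp hlo hhi hE₀ ((1 / 2 : ℝ) • (X + Y))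
      ((1 / 2 : ℝ) • (X - Y)) (c := κ / 4 * (w ^ ((p - 2) / 2) * ‖X - Y‖ ^ 2)) (m := 2)
      (by norm_num) (fun t ht => ?_)
    · have e1 : (1 / 2 : ℝ) • (X + Y) + (1 / 2 : ℝ) • (X - Y) = X := by module
      have e2 : (1 / 2 : ℝ) • (X + Y) - (1 / 2 : ℝ) • (X - Y) = Y := by module
      rw [e1, e2] at key
      have h1 := rpow_le_add_of_weight hp2 (by positivity : 0 < δ ^ (1 / p)) hp hw0
        (norm_nonneg (X - Y))
      have h2 : (δ ^ (1 / p)) ^ p = δ := by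
        rw [← Real.rpow_mul hδ.le]; field_simp; simp
      have hsq : ∀ Z : Rn n, (‖Z‖ ^ 2) ^ (p / 2) = ‖Z‖ ^ p := fun Z => by
        rw [← Real.rpow_natCast, ← Real.rpow_mul (norm_nonneg _)]; congr 1; push_cast; ring
      have h3 : w ^ (p / 2) ≤ 1 + ‖X‖ ^ p + ‖Y‖ ^ p := by
        have i1 := Real.rpow_add_le_add_rpow (p := p / 2)
          (by positivity : 0 ≤ 1 + ‖X‖ ^ 2) (sq_nonneg ‖Y‖)
          (by linarith) (by linarith)
        have i2 := Real.rpow_add_le_add_rpow (p := p / 2) zero_le_one (sq_nonneg ‖X‖)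
          (by linarith) (by linarith)
        rw [hsq] at i1 i2
        rw [Real.one_rpow] at i2
        linarith
      rw [h2] at h1
      have h4 := mul_le_mul_of_nonneg_left h3 hδ.le
      have h5 := mul_le_mul_of_nonneg_left key
        (by positivity : 0 ≤ 4 * (δ ^ (1 / p)) ^ (p - 2) / κ)
      have h6 : 4 * (δ ^ (1 / p)) ^ (p - 2) / κ * (κ / 4 * (w ^ ((p - 2) / 2) * ‖X - Y‖ ^ 2)) =
        (δ ^ (1 / p)) ^ (p - 2) * (w ^ ((p - 2) / 2) * ‖X - Y‖ ^ 2) := by field_simp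
      linarith
    · refine le_trans ?_ (h.mono_lt _ _ hp2)
      set P := (1 / 2 : ℝ) • (X + Y)
      set V := (1 / 2 : ℝ) • (X - Y)
      have hdiff : P + t • V - (P + (-t) • V) = t • (X - Y) := by module
      have hX : P + V = X := by module
      have hY : P - V = Y := by module
      have hpar := parallelogram_law_with_norm ℝ P V
      have hpar2 := parallelogram_law_with_norm ℝ P (t • V)
      rw [hX, hY] at hpar
      rw [norm_smul t V, Real.norm_of_nonneg ht.1.le] at hpar2
      have ht2 : t * t ≤ 1 := by nlinarith [ht.1, ht.2]
      -- By the parallelogram law, symmetric points inside the segment have a smaller sum of squares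
      -- than its endpoints. As the exponent (p - 2)/2 is negative, the weight at the endpoints is
      -- the worst one and is independent of t.
      have hle : 1 + ‖P + t • V‖ ^ 2 + ‖P + (-t) • V‖ ^ 2 ≤ w := by
        rw [neg_smul, ← sub_eq_add_neg, hw]
        nlinarith [mul_self_nonneg ‖V‖, mul_le_mul_of_nonneg_right ht2 (mul_self_nonneg ‖V‖)]
      have hpow := Real.rpow_le_rpow_of_nonpos (by positivity) hle
        (by linarith : (p - 2) / 2 ≤ 0)
      rw [hdiff, norm_smul, Real.norm_of_nonneg ht.1.le]
      have e : (2 : ℝ) - 1 = 1 := by norm_num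
      rw [e, Real.rpow_one]
      calc 2 * t * (κ / 4 * (w ^ ((p - 2) / 2) * ‖X - Y‖ ^ 2) * (2 * t))
          = κ * w ^ ((p - 2) / 2) * (t * ‖X - Y‖) ^ 2 := by ring
        _ ≤ _ := by gcongr


/-! ### Measurability of the energy density along a field -/

/-- The primitive of a Carathéodory function along a measurable upper bound is measurable. -/
lemma aemeasurable_primitive {X : Type*} [MeasurableSpace X] {μ : Measure X} {h : X → ℝ → ℝ}
    (hm : ∀ ξ, AEMeasurable (fun x => h x ξ) μ) (hc : ∀ᵐ x ∂μ, Continuous (h x))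
    {g : X → ℝ} (hg : AEMeasurable g μ) :
    AEMeasurable (fun x => ∫ ξ in (0 : ℝ)..g x, h x ξ) μ := by
  have hall : ∀ᵐ x ∂μ, Continuous (h x) ∧ ∀ r : ℚ, h x r = (hm r).mk _ x :=
    hc.and (ae_all_iff.2 fun r => (hm r).ae_eq_mk)
  -- The exceptional sets of the countably many rational ξ and of continuity fit into one measurable
  -- null set S. Setting h to 0 on S gives a function measurable at rational ξ, hence at all ξ by
  -- continuity.
  obtain ⟨S, hS, hSm, hSμ⟩ := exists_measurable_superset_of_null (ae_iff.1 hall)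
  have hoff : ∀ x ∉ S, Continuous (h x) ∧ ∀ r : ℚ, h x r = (hm r).mk _ x := fun x hx => by
    by_contra hcon; exact hx (hS hcon)
  classical
  let k : X → ℝ → ℝ := fun x ξ => Sᶜ.indicator (fun y => h y ξ) x
  have kc : ∀ x, Continuous (k x) := fun x => by
    by_cases hx : x ∈ S
    · have : k x = fun _ => 0 := by ext; simp [k, hx]
      rw [this]; exact continuous_const
    · have : k x = h x := by ext; simp [k, hx]
      rw [this]; exact (hoff x hx).1
  have kq : ∀ r : ℚ, Measurable (fun x => k x r) := fun r => by
    have : (fun x => k x r) = Sᶜ.indicator ((hm r).mk _) := by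
      ext x
      by_cases hx : x ∈ S
      · simp [k, hx]
      · simp [k, hx, (hoff x hx).2 r]
    rw [this]
    exact (hm r).measurable_mk.indicator hSm.compl
  have km : ∀ ξ : ℝ, Measurable (fun x => k x ξ) := fun ξ => by
    obtain ⟨u, hu, hlim⟩ := mem_closure_iff_seq_limit.1 (Rat.denseRange_cast (𝕜 := ℝ) ξ)
    choose r hr using hu
    refine measurable_of_tendsto_metrizable (f := fun i x => k x (r i)) (fun i => kq (r i)) ?_
    rw [tendsto_pi_nhds]
    intro x
    have := ((kc x).tendsto ξ).comp hlim
    simpa [Function.comp_def, ← hr] using this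
  have kj : Measurable (Function.uncurry k) := by
    have h1 := measurable_uncurry_of_continuous_of_measurable (u := fun ξ x => k x ξ)
      (fun x => kc x) km
    exact h1.comp measurable_swap
  -- The primitive is again continuous in E and measurable in x, hence jointly measurable, and may
  -- be evaluated at E = g x.
  let P : X → ℝ → ℝ := fun x E => ∫ ξ in (0 : ℝ)..E, k x ξ
  have Pc : ∀ x, Continuous (P x) := fun x =>
    intervalIntegral.continuous_primitive (fun a b => (kc x).intervalIntegrable a b) 0
  have Pm : ∀ E, Measurable (fun x => P x E) := fun E => by
    have hs := kj.stronglyMeasurable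
    simp only [P, intervalIntegral]
    exact (hs.integral_prod_right' (ν := volume.restrict (Ioc 0 E))).measurable.sub
      (hs.integral_prod_right' (ν := volume.restrict (Ioc E 0))).measurable
  have Pj : Measurable (Function.uncurry fun E x => P x E) :=
    measurable_uncurry_of_continuous_of_measurable (u := fun E x => P x E) Pc Pm
  refine ⟨fun x => P x (hg.mk g x), Pj.comp (hg.measurable_mk.prodMk measurable_id), ?_⟩
  have hS0 : ∀ᵐ x ∂μ, x ∉ S := by simpa [ae_iff] using hSμ
  filter_upwards [hg.ae_eq_mk, hS0] with x hx hxS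
  have : k x = h x := by ext; simp [k, hxS]
  simp only [P, this, ← hx]

/-- The pointwise form of the structural assumptions. -/
lemma exists_isConductivity {n : ℕ} {p : ℝ} {U : Set (Rn n)} {σ : Rn n → ℝ → ℝ}
    (h1 : IsCaratheodory U σ) (h2 : HasGrowth p U σ) (h3 : IsStronglyMonotone p U σ) :
    ∃ lo hi E₀ κ : ℝ, 0 < lo ∧ 0 < hi ∧ 0 < E₀ ∧ 0 < κ ∧
      ∀ᵐ x ∂(volume.restrict U), IsConductivity n p lo hi E₀ κ (σ x) := by
  obtain ⟨lo, hi, E₀, hlo, hhi, hE₀, hg⟩ := h2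
  obtain ⟨κ, hκ, hm⟩ := h3
  refine ⟨lo, hi, E₀, κ, hlo, hlo.trans_le hhi, hE₀, hκ, ?_⟩
  filter_upwards [h1.2, hg, hm] with x hx1 hx2 hx3
  exact ⟨hx1, fun E hE => (hx2 E hE).1, fun E hE => (hx2 E hE).2.1, fun E hE => (hx2 E hE).2.2,
    fun E₁ E₂ => (hx3 E₁ E₂).1, fun E₁ E₂ => (hx3 E₁ E₂).2⟩

/-! ### Uniformly convex densities -/

/-- The analytic properties of a density `W(x, G)` that are used in the stability argument. -/
structure IsUniformlyConvexDensity {n : ℕ} (p : ℝ) (U : Set (Rn n))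
    (W : Rn n → Rn n → ℝ) : Prop where
  nonneg : ∀ᵐ x ∂(volume.restrict U), ∀ X, 0 ≤ W x X
  convex : ∀ᵐ x ∂(volume.restrict U), ∀ X v : Rn n, ∀ t : ℝ, 0 ≤ t → t ≤ 1 →
    W x (X + t • v) ≤ (1 - t) * W x X + t * W x (X + v)
  upper : ∃ C : ℝ, 0 ≤ C ∧ ∀ᵐ x ∂(volume.restrict U), ∀ X, W x X ≤ C * (1 + ‖X‖ ^ p)
  lower : ∃ C : ℝ, 0 ≤ C ∧ ∀ᵐ x ∂(volume.restrict U), ∀ X, ‖X‖ ^ p ≤ C * W x X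
  uniform : ∀ δ : ℝ, 0 < δ → ∃ K : ℝ, 0 ≤ K ∧ ∀ᵐ x ∂(volume.restrict U), ∀ X Y,
    ‖X - Y‖ ^ p ≤ δ * (1 + ‖X‖ ^ p + ‖Y‖ ^ p) +
      K * (W x X + W x Y - 2 * W x ((1 / 2 : ℝ) • (X + Y)))
  measurable : ∀ G : Rn n → Rn n, AEStronglyMeasurable G (volume.restrict U) →
    AEMeasurable (fun x => W x (G x)) (volume.restrict U)

lemma isUniformlyConvexDensity {n : ℕ} {p : ℝ} (hp : 1 < p) {U : Set (Rn n)}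
    {σ : Rn n → ℝ → ℝ} (h1 : IsCaratheodory U σ) (h2 : HasGrowth p U σ)
    (h3 : IsStronglyMonotone p U σ) :
    IsUniformlyConvexDensity p U (fun x X => energyDensity σ x ‖X‖) := by
  obtain ⟨lo, hi, E₀, κ, hlo, hhi, hE₀, hκ, hc⟩ := exists_isConductivity h1 h2 h3
  have e : ∀ (x X : Rn n), energyDensity σ x ‖X‖ = fluxPrimitive (σ x) ‖X‖ := fun x X =>
    energyDensity_eq_fluxPrimitive σ x (norm_nonneg _)
  simp only [e]
  refine ⟨?_, ?_, ⟨_, ?_, hc.mono fun x hx X => hx.fluxPrimitive_le hp hlo hhi hE₀ (norm_nonneg _)⟩,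
    ⟨(lo * E₀ ^ 2 * ((2 * E₀) ^ p)⁻¹)⁻¹, by positivity, ?_⟩, ?_, ?_⟩
  · exact hc.mono fun x hx X => hx.fluxPrimitive_nonneg hlo hE₀ (norm_nonneg _)
  · exact hc.mono fun x hx X v t ht ht1 => hx.fluxPrimitive_convex hp hlo hhi hE₀ hκ X v ht ht1
  · positivity
  · refine hc.mono fun x hx X => ?_
    rw [inv_mul_eq_div, le_div_iff₀' (by positivity)]
    exact hx.le_fluxPrimitive hp hlo hhi hE₀ (norm_nonneg _)
  · intro δ hδ
    obtain ⟨K, hK, hu⟩ := exists_uniform_convexity n hp hlo hhi hE₀ hκ hδ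
    exact ⟨K, hK, hc.mono fun x hx X Y => hu _ hx X Y⟩
  · intro G hG
    refine aemeasurable_primitive (h := fun x => flux (σ x)) (fun ξ => ?_)
      (hc.mono fun x hx => hx.continuous_flux hp hlo hhi hE₀) hG.norm.aemeasurable
    by_cases hξ : 0 < ξ
    · simpa [flux, hξ] using (h1.1 ξ hξ).mul_const ξ
    · simp [flux, hξ]


/-! ### Integral functionals of a uniformly convex density -/

lemma integrable_norm_rpow_iff_memLp {X E : Type*} [MeasurableSpace X] [NormedAddCommGroup E]
    {μ : Measure X} {p : ℝ} (hp : 0 < p) {G : X → E} (hG : AEStronglyMeasurable G μ) :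
    Integrable (fun x => ‖G x‖ ^ p) μ ↔ MemLp G (ENNReal.ofReal p) μ := by
  have := integrable_norm_rpow_iff (p := ENNReal.ofReal p) hG
    (by simpa using hp) ENNReal.ofReal_ne_top
  rwa [ENNReal.toReal_ofReal hp.le] at this

lemma norm_sub_rpow_le {E : Type*} [NormedAddCommGroup E] {p : ℝ} (hp : 0 < p) (a b : E) :
    ‖a - b‖ ^ p ≤ 2 ^ p * (‖a‖ ^ p + ‖b‖ ^ p) := by
  have h1 : ‖a - b‖ ≤ 2 * max ‖a‖ ‖b‖ := by
    have := norm_sub_le a b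
    have := le_max_left ‖a‖ ‖b‖
    have := le_max_right ‖a‖ ‖b‖
    linarith
  have h2 : ‖a - b‖ ^ p ≤ 2 ^ p * (max ‖a‖ ‖b‖) ^ p := by
    rw [← Real.mul_rpow (by norm_num) (by positivity)]
    exact Real.rpow_le_rpow (norm_nonneg _) h1 hp.le
  refine h2.trans ?_
  gcongr
  have ha : 0 ≤ ‖a‖ ^ p := by positivity
  have hb : 0 ≤ ‖b‖ ^ p := by positivity
  rcases max_choice ‖a‖ ‖b‖ with h | h <;> rw [h] <;> linarith

namespace IsUniformlyConvexDensity

variable {n : ℕ} {p : ℝ} {U : Set (Rn n)} {W : Rn n → Rn n → ℝ}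

lemma integrable [IsFiniteMeasure ((volume : Measure (Rn n)).restrict U)]
    (hW : IsUniformlyConvexDensity p U W) (hp : 1 < p) {G : Rn n → Rn n}
    (hG : MemLp G (ENNReal.ofReal p) (volume.restrict U)) :
    Integrable (fun x => W x (G x)) (volume.restrict U) := by
  obtain ⟨C, hC, hu⟩ := hW.upper
  have hi := (integrable_norm_rpow_iff_memLp (by linarith) hG.1).2 hG
  refine Integrable.mono' (((integrable_const (1 : ℝ)).add hi).const_mul C)
    (hW.measurable G hG.1).aestronglyMeasurable ?_
  filter_upwards [hu, hW.nonneg] with x hx h0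
  rw [Real.norm_of_nonneg (h0 _)]
  exact hx _

lemma lintegral_eq [IsFiniteMeasure ((volume : Measure (Rn n)).restrict U)]
    (hW : IsUniformlyConvexDensity p U W) (hp : 1 < p) {G : Rn n → Rn n}
    (hG : MemLp G (ENNReal.ofReal p) (volume.restrict U)) :
    ∫⁻ x in U, ENNReal.ofReal (W x (G x)) = ENNReal.ofReal (∫ x in U, W x (G x)) := by
  rw [ofReal_integral_eq_lintegral_ofReal (hW.integrable hp hG)]
  exact hW.nonneg.mono fun x hx => hx _

/-- Coercivity upgrades finite energy to integrability. In the two-phase problem a minimizer is a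
priori only in W^{1,min(p,q)}; this puts its gradient in L^p(B) and L^q(A). -/
lemma memLp_of_lintegral_lt_top
    (hW : IsUniformlyConvexDensity p U W) (hp : 1 < p) {G : Rn n → Rn n}
    (hGm : AEStronglyMeasurable G (volume.restrict U))
    (hG : ∫⁻ x in U, ENNReal.ofReal (W x (G x)) < ⊤) :
    MemLp G (ENNReal.ofReal p) (volume.restrict U) := by
  rw [← integrable_norm_rpow_iff_memLp (by linarith) hGm]
  obtain ⟨C, hC, hl⟩ := hW.lower
  have hi : Integrable (fun x => W x (G x)) (volume.restrict U) := by
    refine ⟨(hW.measurable G hGm).aestronglyMeasurable, ?_⟩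
    rw [hasFiniteIntegral_iff_ofReal (hW.nonneg.mono fun x hx => hx _)]
    exact hG
  refine Integrable.mono' (hi.const_mul C)
    (hGm.norm.aemeasurable.pow_const p).aestronglyMeasurable ?_
  filter_upwards [hl] with x hx
  rw [Real.norm_of_nonneg (by positivity)]
  exact hx _

lemma integral_nonneg (hW : IsUniformlyConvexDensity p U W) (G : Rn n → Rn n) :
    0 ≤ ∫ x in U, W x (G x) :=
  integral_nonneg_of_ae (hW.nonneg.mono fun _ hx => hx _)

lemma integral_convex [IsFiniteMeasure ((volume : Measure (Rn n)).restrict U)]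
    (hW : IsUniformlyConvexDensity p U W) (hp : 1 < p) {X v : Rn n → Rn n}
    (hX : MemLp X (ENNReal.ofReal p) (volume.restrict U))
    (hv : MemLp v (ENNReal.ofReal p) (volume.restrict U)) {t : ℝ} (ht : 0 ≤ t) (ht1 : t ≤ 1) :
    ∫ x in U, W x (X x + t • v x) ≤
      (1 - t) * (∫ x in U, W x (X x)) + t * ∫ x in U, W x (X x + v x) := by
  have i1 := (hW.integrable hp hX).const_mul (1 - t)
  have i2 : Integrable (fun x => t * W x (X x + v x)) (volume.restrict U) :=
    (hW.integrable hp (hX.add hv)).const_mul t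
  rw [← integral_const_mul, ← integral_const_mul, ← integral_add i1 i2]
  refine integral_mono_ae (hW.integrable hp (hX.add (hv.const_smul t))) (i1.add i2) ?_
  filter_upwards [hW.convex] with x hx using hx _ _ t ht ht1

lemma integral_norm_rpow_le [IsFiniteMeasure ((volume : Measure (Rn n)).restrict U)]
    (hW : IsUniformlyConvexDensity p U W) (hp : 1 < p) :
    ∃ C : ℝ, 0 ≤ C ∧ ∀ X : Rn n → Rn n, MemLp X (ENNReal.ofReal p) (volume.restrict U) →
      ∫ x in U, ‖X x‖ ^ p ≤ C * ∫ x in U, W x (X x) := by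
  obtain ⟨C, hC, hl⟩ := hW.lower
  refine ⟨C, hC, fun X hX => ?_⟩
  rw [← integral_const_mul]
  refine integral_mono_ae ((integrable_norm_rpow_iff_memLp (by linarith) hX.1).2 hX)
    ((hW.integrable hp hX).const_mul C) ?_
  filter_upwards [hl] with x hx using hx _

/-- Applied with Y = Φ, it bounds the energy of G_ε - Φ by that of G_ε, uniformly in ε; this makes
the error in the lower comparison O(ε). -/
lemma integral_sub_le [IsFiniteMeasure ((volume : Measure (Rn n)).restrict U)]
    (hW : IsUniformlyConvexDensity p U W) (hp : 1 < p) {Y : Rn n → Rn n}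
    (hY : MemLp Y (ENNReal.ofReal p) (volume.restrict U)) :
    ∃ C : ℝ, 0 ≤ C ∧ ∀ X : Rn n → Rn n, MemLp X (ENNReal.ofReal p) (volume.restrict U) →
      ∫ x in U, W x (X x - Y x) ≤ C * (1 + ∫ x in U, W x (X x)) := by
  obtain ⟨C, hC, hu⟩ := hW.upper
  obtain ⟨D, hD, hl⟩ := hW.integral_norm_rpow_le hp
  have iY := (integrable_norm_rpow_iff_memLp (p := p) (by linarith) hY.1).2 hY
  set m := ∫ x in U, (1 : ℝ)
  set I := ∫ x in U, ‖Y x‖ ^ p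
  have hm : 0 ≤ m := integral_nonneg_of_ae (Eventually.of_forall fun _ => zero_le_one)
  have hI : 0 ≤ I := integral_nonneg_of_ae (Eventually.of_forall fun _ => by positivity)
  refine ⟨C * (m + 2 ^ p * I + 2 ^ p * D), by positivity, fun X hX => ?_⟩
  have iX := (integrable_norm_rpow_iff_memLp (p := p) (by linarith) hX.1).2 hX
  have h1 : ∫ x in U, W x (X x - Y x) ≤
      ∫ x in U, C * (1 + 2 ^ p * (‖X x‖ ^ p + ‖Y x‖ ^ p)) := by
    refine integral_mono_ae (hW.integrable hp (hX.sub hY))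
      (((integrable_const 1).add ((iX.add iY).const_mul _)).const_mul C) ?_
    filter_upwards [hu] with x hx
    refine (hx _).trans ?_
    have := norm_sub_rpow_le (p := p) (by linarith) (X x) (Y x)
    gcongr
  have h2 : ∫ x in U, C * (1 + 2 ^ p * (‖X x‖ ^ p + ‖Y x‖ ^ p)) =
      C * (m + 2 ^ p * ((∫ x in U, ‖X x‖ ^ p) + I)) := by
    have i : Integrable (fun x => 2 ^ p * (‖X x‖ ^ p + ‖Y x‖ ^ p)) (volume.restrict U) :=
      (iX.add iY).const_mul _
    rw [integral_const_mul, integral_add (integrable_const 1) i,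
      integral_const_mul, integral_add iX iY]
  rw [h2] at h1
  refine h1.trans ?_
  rw [mul_assoc]
  refine mul_le_mul_of_nonneg_left ?_ hC
  have h3 := mul_le_mul_of_nonneg_left (hl X hX) (by positivity : 0 ≤ (2 : ℝ) ^ p)
  have h4 := hW.integral_nonneg X
  have h5 : 0 ≤ (m + 2 ^ p * I) * ∫ x in U, W x (X x) := by positivity
  have h6 : 0 ≤ (2 : ℝ) ^ p * D := by positivity
  nlinarith

lemma integral_uniform [IsFiniteMeasure ((volume : Measure (Rn n)).restrict U)]
    (hW : IsUniformlyConvexDensity p U W) (hp : 1 < p) {δ : ℝ} (hδ : 0 < δ) :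
    ∃ K : ℝ, 0 ≤ K ∧ ∀ X Y : Rn n → Rn n, MemLp X (ENNReal.ofReal p) (volume.restrict U) →
      MemLp Y (ENNReal.ofReal p) (volume.restrict U) →
      ∫ x in U, ‖X x - Y x‖ ^ p ≤ δ * (1 + (∫ x in U, W x (X x)) + ∫ x in U, W x (Y x)) +
        K * ((∫ x in U, W x (X x)) + (∫ x in U, W x (Y x)) -
          2 * ∫ x in U, W x ((1 / 2 : ℝ) • (X x + Y x))) := by
  obtain ⟨D, hD, hl⟩ := hW.integral_norm_rpow_le hp
  set m := ∫ x in U, (1 : ℝ)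
  have hm : 0 ≤ m := integral_nonneg_of_ae (Eventually.of_forall fun _ => zero_le_one)
  -- Here m is the measure of U and D the coercivity constant, so 1 + |X|^p + |Y|^p integrates to at
  -- most m + D(J(X) + J(Y)); dividing δ by m + D + 1 absorbs this factor.
  obtain ⟨K, hK, hu⟩ := hW.uniform (δ / (m + D + 1)) (by positivity)
  refine ⟨K, hK, fun X Y hX hY => ?_⟩
  have iX := (integrable_norm_rpow_iff_memLp (p := p) (by linarith) hX.1).2 hX
  have iY := (integrable_norm_rpow_iff_memLp (p := p) (by linarith) hY.1).2 hY
  have jX := hW.integrable hp hX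
  have jY := hW.integrable hp hY
  have jM : Integrable (fun x => W x ((1 / 2 : ℝ) • (X x + Y x))) (volume.restrict U) :=
    hW.integrable hp ((hX.add hY).const_smul (1 / 2 : ℝ))
  have i1 : Integrable (fun x => 1 + ‖X x‖ ^ p) (volume.restrict U) := (integrable_const 1).add iX
  have i2 : Integrable (fun x => δ / (m + D + 1) * (1 + ‖X x‖ ^ p + ‖Y x‖ ^ p))
    (volume.restrict U) := (i1.add iY).const_mul _
  have j1 : Integrable (fun x => W x (X x) + W x (Y x)) (volume.restrict U) := jX.add jY
  have j2 : Integrable (fun x => K * (W x (X x) + W x (Y x) -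
    2 * W x ((1 / 2 : ℝ) • (X x + Y x)))) (volume.restrict U) :=
    (j1.sub (jM.const_mul 2)).const_mul K
  have hle : ∫ x in U, ‖X x - Y x‖ ^ p ≤ _ := integral_mono_ae
    ((integrable_norm_rpow_iff_memLp (p := p) (by linarith) (hX.sub hY).1).2 (hX.sub hY))
    (i2.add j2) (hu.mono fun x hx => hx (X x) (Y x))
  refine hle.trans ?_
  simp only [Pi.add_apply]
  rw [integral_add i2 j2, integral_const_mul, integral_const_mul, integral_add i1 iY,
    integral_add (integrable_const (1 : ℝ)) iX, integral_sub j1 (jM.const_mul 2),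
    integral_const_mul, integral_add jX jY]
  have e1 : m + (∫ x in U, ‖X x‖ ^ p) + (∫ x in U, ‖Y x‖ ^ p) ≤
      (m + D + 1) * (1 + (∫ x in U, W x (X x)) + ∫ x in U, W x (Y x)) := by
    have a1 := hl X hX
    have a2 := hl Y hY
    have a3 := hW.integral_nonneg X
    have a4 := hW.integral_nonneg Y
    nlinarith [mul_nonneg hm a3, mul_nonneg hm a4]
  have e2 := mul_le_mul_of_nonneg_left e1 (by positivity : 0 ≤ δ / (m + D + 1))
  have e3 : δ / (m + D + 1) * ((m + D + 1) * (1 + (∫ x in U, W x (X x)) + ∫ x in U, W x (Y x))) =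
      δ * (1 + (∫ x in U, W x (X x)) + ∫ x in U, W x (Y x)) := by
    have : m + D + 1 ≠ 0 := by positivity
    field_simp
  exact add_le_add (e2.trans e3.le) le_rfl

/-- Minimality controls only the sum of the defects of the two regions. Since each is nonnegative,
each one is controlled separately. -/
lemma midpoint_defect_nonneg [IsFiniteMeasure ((volume : Measure (Rn n)).restrict U)]
    (hW : IsUniformlyConvexDensity p U W) (hp : 1 < p) {X Y : Rn n → Rn n}
    (hX : MemLp X (ENNReal.ofReal p) (volume.restrict U))
    (hY : MemLp Y (ENNReal.ofReal p) (volume.restrict U)) :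
    0 ≤ (∫ x in U, W x (X x)) + (∫ x in U, W x (Y x)) -
      2 * ∫ x in U, W x ((1 / 2 : ℝ) • (X x + Y x)) := by
  have h := hW.integral_convex hp hX (hY.sub hX) (by norm_num : (0 : ℝ) ≤ 1 / 2) (by norm_num)
  have e : ∀ x, X x + (1 / 2 : ℝ) • (Y - X) x = (1 / 2 : ℝ) • (X x + Y x) := fun x => by
    simp only [Pi.sub_apply]; module
  have e2 : ∀ x, X x + (Y - X) x = Y x := fun x => by simp
  simp only [e, e2] at h
  linarith

/-- A small midpoint defect forces closeness in `L^p`. -/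
lemma tendsto_integral_norm_rpow [IsFiniteMeasure ((volume : Measure (Rn n)).restrict U)]
    (hW : IsUniformlyConvexDensity p U W) (hp : 1 < p) {X Y : ℝ → Rn n → Rn n} {M : ℝ}
    (hX : ∀ ε, 0 < ε → MemLp (X ε) (ENNReal.ofReal p) (volume.restrict U))
    (hY : ∀ ε, 0 < ε → MemLp (Y ε) (ENNReal.ofReal p) (volume.restrict U))
    (hXM : ∀ ε, 0 < ε → ε ≤ 1 → ∫ x in U, W x (X ε x) ≤ M)
    (hYM : ∀ ε, 0 < ε → ε ≤ 1 → ∫ x in U, W x (Y ε x) ≤ M)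
    (hd : ∀ ε, 0 < ε → ε ≤ 1 → (∫ x in U, W x (X ε x)) + (∫ x in U, W x (Y ε x)) -
      2 * ∫ x in U, W x ((1 / 2 : ℝ) • (X ε x + Y ε x)) ≤ M * ε) :
    Tendsto (fun ε => ∫ x in U, ‖X ε x - Y ε x‖ ^ p) (𝓝[>] 0) (𝓝 0) := by
  have hM : 0 ≤ M := (hW.integral_nonneg _).trans (hXM 1 one_pos le_rfl)
  rw [Metric.tendsto_nhds]
  intro η hη
  obtain ⟨K, hK, hu⟩ := hW.integral_uniform hp (δ := η / (2 * (1 + M + M))) (by positivity)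
  have hsmall : ∀ᶠ ε : ℝ in 𝓝[>] 0, K * (M * ε) < η / 2 := by
    have : Tendsto (fun ε : ℝ => K * (M * ε)) (𝓝[>] 0) (𝓝 0) := by
      have hc : Continuous fun ε : ℝ => K * (M * ε) := by fun_prop
      have := hc.tendsto 0
      simp only [mul_zero] at this
      exact this.mono_left nhdsWithin_le_nhds
    exact this.eventually (gt_mem_nhds (by positivity))
  filter_upwards [hsmall, Ioc_mem_nhdsGT (zero_lt_one (α := ℝ))] with ε h1 h2
  have h3 := hu (X ε) (Y ε) (hX ε h2.1) (hY ε h2.1)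
  have h4 := mul_le_mul_of_nonneg_left (hd ε h2.1 h2.2) hK
  have h5 : η / (2 * (1 + M + M)) * (1 + (∫ x in U, W x (X ε x)) + ∫ x in U, W x (Y ε x)) ≤
      η / 2 := by
    calc _ ≤ η / (2 * (1 + M + M)) * (1 + M + M) := by
          gcongr
          · exact hXM ε h2.1 h2.2
          · exact hYM ε h2.1 h2.2
      _ = η / 2 := by field_simp
  rw [Real.dist_eq, sub_zero, abs_of_nonneg
    (integral_nonneg_of_ae (Eventually.of_forall fun _ => by positivity))]
  linarith

end IsUniformlyConvexDensity

/-! ### Stability of minimizing fields -/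

lemma convergesInLp_of_integral {n : ℕ} {p : ℝ} (hp : 1 < p) {U : Set (Rn n)}
    {G : ℝ → Rn n → Rn n} {G₀ Φ : Rn n → Rn n}
    (hG₀ : MemLp G₀ (ENNReal.ofReal p) (volume.restrict U))
    (hΦ : MemLp Φ (ENNReal.ofReal p) (volume.restrict U))
    (hG : ∀ ε, 0 < ε → MemLp (G ε) (ENNReal.ofReal p) (volume.restrict U))
    (hlim : Tendsto (fun ε => ∫ x in U, ‖G ε x - (G₀ x + ε • Φ x)‖ ^ p) (𝓝[>] 0) (𝓝 0)) :
    ConvergesInLp p U G G₀ := by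
  have hp0 : 0 < p := by linarith
  have hp1 : 1 ≤ ENNReal.ofReal p := by simpa using hp.le
  refine ⟨hG₀, hG, ?_⟩
  set μ := (volume : Measure (Rn n)).restrict U
  have hle : ∀ᶠ ε : ℝ in 𝓝[>] 0, eLpNorm (fun x => G ε x - G₀ x) (ENNReal.ofReal p) μ ≤
      ENNReal.ofReal ((∫ x in U, ‖G ε x - (G₀ x + ε • Φ x)‖ ^ p) ^ p⁻¹) +
        ENNReal.ofReal ε * eLpNorm Φ (ENNReal.ofReal p) μ := by
    filter_upwards [self_mem_nhdsWithin] with ε (hε : 0 < ε)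
    have hY := hG₀.add (hΦ.const_smul ε)
    -- G_ε - G₀ is the distance to the shifted field G₀ + εΦ plus the explicit correction εΦ, whose
    -- norm is linear in ε.
    have e : (fun x => G ε x - G₀ x) = (G ε - (G₀ + ε • Φ)) + ε • Φ := by
      ext1 x; simp only [Pi.add_apply, Pi.sub_apply, Pi.smul_apply]; abel
    rw [e]
    refine (eLpNorm_add_le ((hG ε hε).sub hY).1 (hΦ.const_smul ε).1 hp1).trans ?_
    gcongr
    · rw [((hG ε hε).sub hY).eLpNorm_eq_integral_rpow_norm (by simpa using hp0)
        ENNReal.ofReal_ne_top, ENNReal.toReal_ofReal hp0.le]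
      rfl
    · rw [eLpNorm_const_smul, Real.enorm_of_nonneg hε.le]
  refine tendsto_of_tendsto_of_tendsto_of_le_of_le' tendsto_const_nhds ?_
    (Eventually.of_forall fun _ => zero_le) hle
  have t1 : Tendsto (fun ε => ENNReal.ofReal ((∫ x in U, ‖G ε x - (G₀ x + ε • Φ x)‖ ^ p) ^ p⁻¹))
      (𝓝[>] 0) (𝓝 0) := by
    have := (hlim.rpow_const (p := p⁻¹) (Or.inr (by positivity)))
    rw [Real.zero_rpow (by positivity)] at this
    simpa using ENNReal.tendsto_ofReal this
  have t2 : Tendsto (fun ε : ℝ => ENNReal.ofReal ε * eLpNorm Φ (ENNReal.ofReal p) μ)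
      (𝓝[>] 0) (𝓝 0) := by
    have h0 : Tendsto (fun ε : ℝ => ENNReal.ofReal ε) (𝓝[>] 0) (𝓝 0) := by
      simpa using ENNReal.tendsto_ofReal
        ((tendsto_id (α := ℝ) (x := 𝓝 0)).mono_left (nhdsWithin_le_nhds (s := Ioi 0)))
    simpa using ENNReal.Tendsto.mul_const h0 (Or.inr hΦ.2.ne)
  simpa using t1.add t2

/-- Stability of minimizing fields under a small affine perturbation of the admissible class. -/
theorem convergesInLp_of_minimality {n : ℕ} {p q : ℝ} (hp : 1 < p) (hq : 1 < q)
    {U V : Set (Rn n)} [IsFiniteMeasure ((volume : Measure (Rn n)).restrict U)]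
    [IsFiniteMeasure ((volume : Measure (Rn n)).restrict V)] {σ : Rn n → ℝ → ℝ}
    (hU : IsUniformlyConvexDensity p U fun x X => energyDensity σ x ‖X‖)
    (hV : IsUniformlyConvexDensity q V fun x X => energyDensity σ x ‖X‖)
    {G : ℝ → Rn n → Rn n} {G₀ Φ : Rn n → Rn n}
    (hG₀U : AEStronglyMeasurable G₀ (volume.restrict U))
    (hG₀V : AEStronglyMeasurable G₀ (volume.restrict V))
    (hG₀ : energy σ U G₀ + energy σ V G₀ < ⊤)
    (hΦU : MemLp Φ (ENNReal.ofReal p) (volume.restrict U))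
    (hΦV : MemLp Φ (ENNReal.ofReal q) (volume.restrict V))
    (hGU : ∀ ε, 0 < ε → AEStronglyMeasurable (G ε) (volume.restrict U))
    (hGV : ∀ ε, 0 < ε → AEStronglyMeasurable (G ε) (volume.restrict V))
    (hmid : ∀ ε, 0 < ε → energy σ U (G ε) + energy σ V (G ε) ≤
      energy σ U (fun x => (1 / 2 : ℝ) • (G ε x + (G₀ x + ε • Φ x))) +
        energy σ V (fun x => (1 / 2 : ℝ) • (G ε x + (G₀ x + ε • Φ x))))
    (hup : ∀ ε, 0 < ε → energy σ U (G ε) + energy σ V (G ε) ≤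
      energy σ U (fun x => G₀ x + ε • Φ x) + energy σ V (fun x => G₀ x + ε • Φ x))
    (hdown : ∀ ε, 0 < ε → energy σ U G₀ + energy σ V G₀ ≤
      energy σ U (fun x => G ε x - ε • Φ x) + energy σ V (fun x => G ε x - ε • Φ x)) :
    ConvergesInLp p U G G₀ ∧ ConvergesInLp q V G G₀ := by
  have mG₀U := hU.memLp_of_lintegral_lt_top hp hG₀U (lt_of_le_of_lt le_self_add hG₀)
  have mG₀V := hV.memLp_of_lintegral_lt_top hq hG₀V (lt_of_le_of_lt le_add_self hG₀)
  have mYU : ∀ ε : ℝ, MemLp (fun x => G₀ x + ε • Φ x) (ENNReal.ofReal p) (volume.restrict U) :=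
    fun ε => mG₀U.add (hΦU.const_smul ε)
  have mYV : ∀ ε : ℝ, MemLp (fun x => G₀ x + ε • Φ x) (ENNReal.ofReal q) (volume.restrict V) :=
    fun ε => mG₀V.add (hΦV.const_smul ε)
  set JU : (Rn n → Rn n) → ℝ := fun X => ∫ x in U, energyDensity σ x ‖X x‖ with hJU
  set JV : (Rn n → Rn n) → ℝ := fun X => ∫ x in V, energyDensity σ x ‖X x‖ with hJV
  have eU : ∀ X, MemLp X (ENNReal.ofReal p) (volume.restrict U) →
      energy σ U X = ENNReal.ofReal (JU X) := fun X hX => hU.lintegral_eq hp hX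
  have eV : ∀ X, MemLp X (ENNReal.ofReal q) (volume.restrict V) →
      energy σ V X = ENNReal.ofReal (JV X) := fun X hX => hV.lintegral_eq hq hX
  have nU : ∀ X, 0 ≤ JU X := fun X => hU.integral_nonneg X
  have nV : ∀ X, 0 ≤ JV X := fun X => hV.integral_nonneg X
  have hfin : ∀ ε, 0 < ε → energy σ U (G ε) + energy σ V (G ε) < ⊤ := fun ε hε => by
    refine (hup ε hε).trans_lt ?_
    rw [eU _ (mYU ε), eV _ (mYV ε)]
    exact ENNReal.add_lt_top.2 ⟨ENNReal.ofReal_lt_top, ENNReal.ofReal_lt_top⟩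
  have mGU : ∀ ε, 0 < ε → MemLp (G ε) (ENNReal.ofReal p) (volume.restrict U) := fun ε hε =>
    hU.memLp_of_lintegral_lt_top hp (hGU ε hε) (lt_of_le_of_lt le_self_add (hfin ε hε))
  have mGV : ∀ ε, 0 < ε → MemLp (G ε) (ENNReal.ofReal q) (volume.restrict V) := fun ε hε =>
    hV.memLp_of_lintegral_lt_top hq (hGV ε hε) (lt_of_le_of_lt le_add_self (hfin ε hε))
  have real_le : ∀ X Y, MemLp X (ENNReal.ofReal p) (volume.restrict U) →
      MemLp X (ENNReal.ofReal q) (volume.restrict V) →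
      MemLp Y (ENNReal.ofReal p) (volume.restrict U) →
      MemLp Y (ENNReal.ofReal q) (volume.restrict V) →
      energy σ U X + energy σ V X ≤ energy σ U Y + energy σ V Y →
      JU X + JV X ≤ JU Y + JV Y := by
    intro X Y h1 h2 h3 h4 h
    rw [eU _ h1, eV _ h2, eU _ h3, eV _ h4, ← ENNReal.ofReal_add (nU _) (nV _),
      ← ENNReal.ofReal_add (nU _) (nV _)] at h
    exact (ENNReal.ofReal_le_ofReal_iff (add_nonneg (nU _) (nV _))).1 h
  obtain ⟨CU, hCU, hsU⟩ := hU.integral_sub_le hp hΦU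
  obtain ⟨CV, hCV, hsV⟩ := hV.integral_sub_le hq hΦV
  set N := JU (fun x => G₀ x + Φ x) + JV (fun x => G₀ x + Φ x) with hN
  have hN0 : 0 ≤ N := add_nonneg (nU _) (nV _)
  set J₀ := JU G₀ + JV G₀ with hJ₀
  have hJ₀0 : 0 ≤ J₀ := add_nonneg (nU _) (nV _)
  -- C bounds the total energy of G_ε - Φ for ε ≤ 1, because the energy of G_ε is then at most J₀ +
  -- N.
  set C := CU * (1 + (J₀ + N)) + CV * (1 + (J₀ + N)) with hC
  have hC0 : 0 ≤ C := by positivity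
  have key : ∀ ε : ℝ, 0 < ε → ε ≤ 1 →
      JU (fun x => G₀ x + ε • Φ x) + JV (fun x => G₀ x + ε • Φ x) ≤ J₀ + N ∧
      JU (G ε) + JV (G ε) ≤ J₀ + N ∧
      (JU (G ε) + JV (G ε)) + (JU (fun x => G₀ x + ε • Φ x) + JV (fun x => G₀ x + ε • Φ x)) -
        2 * (JU (fun x => (1 / 2 : ℝ) • (G ε x + (G₀ x + ε • Φ x))) +
          JV (fun x => (1 / 2 : ℝ) • (G ε x + (G₀ x + ε • Φ x)))) ≤ ε * (N + C) := by
    intro ε hε hε1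
    -- `c1` and `c2` give J(G₀ + εΦ) ≤ (1 - ε)J₀ + εN. `c3` and `c4` give J(G_ε - εΦ) ≤ (1 -
    -- ε)J(G_ε) + εJ(G_ε - Φ), which with `hdown` bounds J₀ by J(G_ε) + εC.
    have c1 := hU.integral_convex hp mG₀U hΦU hε.le hε1
    have c2 := hV.integral_convex hq mG₀V hΦV hε.le hε1
    have c3 := hU.integral_convex hp (mGU ε hε) hΦU.neg hε.le hε1
    have c4 := hV.integral_convex hq (mGV ε hε) hΦV.neg hε.le hε1
    simp only [Pi.neg_apply, smul_neg, ← sub_eq_add_neg] at c3 c4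
    have s1 := hsU (G ε) (mGU ε hε)
    have s2 := hsV (G ε) (mGV ε hε)
    have r1 := real_le _ _ (mGU ε hε) (mGV ε hε) (mYU ε) (mYV ε) (hup ε hε)
    have r2 := real_le _ _ (mGU ε hε) (mGV ε hε)
      (((mGU ε hε).add (mYU ε)).const_smul (1 / 2 : ℝ))
      (((mGV ε hε).add (mYV ε)).const_smul (1 / 2 : ℝ)) (hmid ε hε)
    have r3 := real_le _ _ mG₀U mG₀V ((mGU ε hε).sub (hΦU.const_smul ε))
      ((mGV ε hε).sub (hΦV.const_smul ε)) (hdown ε hε)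
    simp only [hJU, hJV] at r1 r2 r3 hN hJ₀ nU nV ⊢
    simp only [Pi.sub_apply, Pi.add_apply, Pi.smul_apply] at r2 r3
    have a1 := nU (G ε)
    have a2 := nV (G ε)
    have a3 := nU G₀
    have a4 := nV G₀
    have b1 : (∫ x in U, energyDensity σ x ‖G₀ x + ε • Φ x‖) +
        (∫ x in V, energyDensity σ x ‖G₀ x + ε • Φ x‖) ≤ J₀ + ε * N := by
      have := mul_nonneg hε.le hJ₀0
      rw [hN]; rw [hJ₀] at this ⊢; linarith
    have b2 : ε * N ≤ N := by nlinarith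
    have b3 : (∫ x in U, energyDensity σ x ‖G ε x‖) + (∫ x in V, energyDensity σ x ‖G ε x‖) ≤
        J₀ + N := by linarith
    have d1 : (∫ x in U, energyDensity σ x ‖G ε x - Φ x‖) ≤ CU * (1 + (J₀ + N)) :=
      s1.trans (by gcongr; linarith)
    have d2 : (∫ x in V, energyDensity σ x ‖G ε x - Φ x‖) ≤ CV * (1 + (J₀ + N)) :=
      s2.trans (by gcongr; linarith)
    have d3 : ε * ((∫ x in U, energyDensity σ x ‖G ε x - Φ x‖) +
        ∫ x in V, energyDensity σ x ‖G ε x - Φ x‖) ≤ ε * C := by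
      rw [hC]; gcongr
    have d4 := mul_nonneg hε.le a1
    have d5 := mul_nonneg hε.le a2
    refine ⟨by linarith, b3, ?_⟩
    linarith
  -- The defect in V is dropped from the sum when estimating in U, and conversely.
  have dU := fun (ε : ℝ) (hε : 0 < ε) => hU.midpoint_defect_nonneg hp (mGU ε hε) (mYU ε)
  have dV := fun (ε : ℝ) (hε : 0 < ε) => hV.midpoint_defect_nonneg hq (mGV ε hε) (mYV ε)
  set M := max (J₀ + N) (N + C)
  have hM1 : J₀ + N ≤ M := le_max_left _ _
  have hM2 : N + C ≤ M := le_max_right _ _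
  constructor
  · refine convergesInLp_of_integral hp mG₀U hΦU mGU
      (hU.tendsto_integral_norm_rpow hp (M := M) mGU (fun ε _ => mYU ε) ?_ ?_ ?_)
    · intro ε h0 h1
      have := (key ε h0 h1).2.1
      have := nV (G ε)
      show JU (G ε) ≤ M
      linarith
    · intro ε h0 h1
      have := (key ε h0 h1).1
      have := nV (fun x => G₀ x + ε • Φ x)
      show JU (fun x => G₀ x + ε • Φ x) ≤ M
      linarith
    · intro ε h0 h1
      have k := (key ε h0 h1).2.2
      have d := dV ε h0
      have hm : ε * (N + C) ≤ M * ε := by rw [mul_comm]; gcongr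
      simp only [hJU, hJV] at k
      linarith
  · refine convergesInLp_of_integral hq mG₀V hΦV mGV
      (hV.tendsto_integral_norm_rpow hq (M := M) mGV (fun ε _ => mYV ε) ?_ ?_ ?_)
    · intro ε h0 h1
      have := (key ε h0 h1).2.1
      have := nU (G ε)
      show JV (G ε) ≤ M
      linarith
    · intro ε h0 h1
      have := (key ε h0 h1).1
      have := nU (fun x => G₀ x + ε • Φ x)
      show JV (fun x => G₀ x + ε • Φ x) ≤ M
      linarith
    · intro ε h0 h1
      have k := (key ε h0 h1).2.2
      have d := dU ε h0
      have hm : ε * (N + C) ≤ M * ε := by rw [mul_comm]; gcongr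
      simp only [hJU, hJV] at k
      linarith


/-! ### Weak gradients -/

lemma gradient_eq_toDual {n : ℕ} (ψ : Rn n → ℝ) (x : Rn n) :
    gradient ψ x = (InnerProductSpace.toDual ℝ (Rn n)).symm (fderiv ℝ ψ x) := rfl

lemma continuous_gradient {n : ℕ} {ψ : Rn n → ℝ} (hψ : ContDiff ℝ 1 ψ) :
    Continuous (gradient ψ) :=
  (InnerProductSpace.toDual ℝ (Rn n)).symm.continuous.comp (hψ.continuous_fderiv one_ne_zero)

lemma gradient_eq_zero_of_notMem_tsupport {n : ℕ} {ψ : Rn n → ℝ} {x : Rn n}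
    (hx : x ∉ tsupport ψ) : gradient ψ x = 0 := by
  have h : fderiv ℝ ψ x = 0 := by
    by_contra h
    exact hx (support_fderiv_subset ℝ (Function.mem_support.2 h))
  rw [gradient_eq_toDual, h, map_zero]

lemma gradient_linComb {n : ℕ} {ψ χ : Rn n → ℝ} (hψ : ContDiff ℝ 1 ψ) (hχ : ContDiff ℝ 1 χ)
    (a b : ℝ) (x : Rn n) :
    gradient (fun y => a * ψ y + b * χ y) x = a • gradient ψ x + b • gradient χ x := by
  have h1 := (hψ.differentiable one_ne_zero x).hasFDerivAt.const_mul a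
  have h2 := (hχ.differentiable one_ne_zero x).hasFDerivAt.const_mul b
  have h : fderiv ℝ (fun y => a * ψ y + b * χ y) x = _ := (h1.add h2).fderiv
  rw [gradient_eq_toDual, h]
  simp [gradient_eq_toDual]

lemma gradient_mul {n : ℕ} {ψ χ : Rn n → ℝ} (hψ : ContDiff ℝ 1 ψ) (hχ : ContDiff ℝ 1 χ)
    (x : Rn n) :
    gradient (fun y => ψ y * χ y) x = ψ x • gradient χ x + χ x • gradient ψ x := by
  have h1 := (hψ.differentiable one_ne_zero x).hasFDerivAt.mul
    (hχ.differentiable one_ne_zero x).hasFDerivAt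
  have h : fderiv ℝ (fun y => ψ y * χ y) x = _ := h1.fderiv
  rw [gradient_eq_toDual, h]
  simp [gradient_eq_toDual]

lemma integrableOn_smul_of_tsupport {n : ℕ} {E : Type*} [NormedAddCommGroup E] [NormedSpace ℝ E]
    {U : Set (Rn n)} {ψ : Rn n → ℝ} {G : Rn n → E} (hG : LocallyIntegrableOn G U)
    (hψ : Continuous ψ) (hc : HasCompactSupport ψ) (hs : tsupport ψ ⊆ U) :
    IntegrableOn (fun x => ψ x • G x) U := by
  have h1 : IntegrableOn (fun x => ψ x • G x) (tsupport ψ) :=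
    (hG.integrableOn_compact_subset hs hc).continuousOn_smul hψ.continuousOn hc
  refine ((integrableOn_iff_integrable_of_support_subset ?_).1 h1).integrableOn
  intro x hx
  by_contra hn
  exact hx (by simp [image_eq_zero_of_notMem_tsupport hn])

lemma integrableOn_smul_gradient {n : ℕ} {U : Set (Rn n)} {ψ : Rn n → ℝ} {u : Rn n → ℝ}
    (hu : LocallyIntegrableOn u U) (hψ : ContDiff ℝ 1 ψ) (hc : HasCompactSupport ψ)
    (hs : tsupport ψ ⊆ U) : IntegrableOn (fun x => u x • gradient ψ x) U := by
  have h1 : IntegrableOn (fun x => u x • gradient ψ x) (tsupport ψ) :=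
    (hu.integrableOn_compact_subset hs hc).smul_continuousOn
      (continuous_gradient hψ).continuousOn hc
  refine ((integrableOn_iff_integrable_of_support_subset ?_).1 h1).integrableOn
  intro x hx
  by_contra hn
  exact hx (by simp [gradient_eq_zero_of_notMem_tsupport hn])

lemma HasWeakGrad.linComb {n : ℕ} {U : Set (Rn n)} {u v : Rn n → ℝ} {G H : Rn n → Rn n}
    (hu : HasWeakGrad U u G) (hv : HasWeakGrad U v H) (a b : ℝ) :
    HasWeakGrad U (fun x => a * u x + b * v x) (fun x => a • G x + b • H x) := by
  refine ⟨(hu.1.smul a).add (hv.1.smul b), (hu.2.1.smul a).add (hv.2.1.smul b), ?_⟩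
  intro ψ hψ hc hs
  have hψ1 : ContDiff ℝ 1 ψ := hψ.of_le (by exact_mod_cast le_top)
  have i1 := (integrableOn_smul_gradient hu.1 hψ1 hc hs).smul a
  have i2 := (integrableOn_smul_gradient hv.1 hψ1 hc hs).smul b
  have j1 := (integrableOn_smul_of_tsupport hu.2.1 hψ.continuous hc hs).smul a
  have j2 := (integrableOn_smul_of_tsupport hv.2.1 hψ.continuous hc hs).smul b
  have e1 : ∀ x, (a * u x + b * v x) • gradient ψ x =
      (a • fun x => u x • gradient ψ x) x + (b • fun x => v x • gradient ψ x) x := fun x => by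
    simp only [Pi.smul_apply]; module
  have e2 : ∀ x, ψ x • (a • G x + b • H x) =
      (a • fun x => ψ x • G x) x + (b • fun x => ψ x • H x) x := fun x => by
    simp only [Pi.smul_apply]; module
  simp only [e1, e2]
  rw [integral_add i1 i2, integral_add j1 j2]
  simp only [Pi.smul_apply]
  rw [integral_smul, integral_smul, integral_smul, integral_smul, hu.2.2 ψ hψ hc hs,
    hv.2.2 ψ hψ hc hs]
  module

lemma HasWeakGrad.mono {n : ℕ} {U V : Set (Rn n)} (hVU : V ⊆ U) {u : Rn n → ℝ} {G : Rn n → Rn n}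
    (h : HasWeakGrad U u G) : HasWeakGrad V u G := by
  refine ⟨h.1.mono_set hVU, h.2.1.mono_set hVU, fun ψ hψ hc hs => ?_⟩
  have key := h.2.2 ψ hψ hc (hs.trans hVU)
  have hz : ∀ {W : Set (Rn n)}, tsupport ψ ⊆ W →
      (∫ x in W, u x • gradient ψ x) = ∫ x, u x • gradient ψ x ∧
      (∫ x in W, ψ x • G x) = ∫ x, ψ x • G x := fun hW =>
    ⟨setIntegral_eq_integral_of_forall_compl_eq_zero fun x hx => by
        simp [gradient_eq_zero_of_notMem_tsupport fun h => hx (hW h)],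
      setIntegral_eq_integral_of_forall_compl_eq_zero fun x hx => by
        simp [image_eq_zero_of_notMem_tsupport fun h => hx (hW h)]⟩
  rw [(hz hs).1, (hz hs).2]
  rwa [(hz (hs.trans hVU)).1, (hz (hs.trans hVU)).2] at key

/-- The fundamental lemma of the calculus of variations applied to G - H; it makes the chosen
`weakGrad` independent of the choice up to null sets. -/
lemma HasWeakGrad.ae_eq {n : ℕ} {U : Set (Rn n)} (hU : IsOpen U) {u : Rn n → ℝ}
    {G H : Rn n → Rn n} (hG : HasWeakGrad U u G) (hH : HasWeakGrad U u H) :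
    G =ᵐ[volume.restrict U] H := by
  rw [Filter.EventuallyEq, ae_restrict_iff' hU.measurableSet]
  have := hU.ae_eq_zero_of_integral_contDiff_smul_eq_zero (μ := volume) (hG.2.1.sub hH.2.1)
    (fun ψ hψ hc hs => ?_)
  · filter_upwards [this] with x hx hxU
    exact sub_eq_zero.1 (hx hxU)
  · have e : (∫ x, ψ x • (G - H) x) = ∫ x in U, ψ x • (G - H) x :=
      (setIntegral_eq_integral_of_forall_compl_eq_zero fun x hx => by
        simp [image_eq_zero_of_notMem_tsupport fun h => hx (hs h)]).symm
    have j1 := integrableOn_smul_of_tsupport hG.2.1 hψ.continuous hc hs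
    have j2 := integrableOn_smul_of_tsupport hH.2.1 hψ.continuous hc hs
    simp only [Pi.sub_apply, smul_sub] at e ⊢
    rw [e, integral_sub j1 j2, sub_eq_zero]
    exact neg_injective ((hG.2.2 ψ hψ hc hs).symm.trans (hH.2.2 ψ hψ hc hs))

lemma HasWeakGrad.weakGrad {n : ℕ} {U : Set (Rn n)} {u : Rn n → ℝ} {G : Rn n → Rn n}
    (h : HasWeakGrad U u G) : HasWeakGrad U u (weakGrad U u) := by
  have hex : ∃ G, HasWeakGrad U u G := ⟨G, h⟩
  rw [PiecewiseNonlinear.weakGrad, dif_pos hex]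
  exact hex.choose_spec

lemma HasWeakGrad.weakGrad_ae_eq {n : ℕ} {U : Set (Rn n)} (hU : IsOpen U) {u : Rn n → ℝ}
    {G : Rn n → Rn n} (h : HasWeakGrad U u G) : PiecewiseNonlinear.weakGrad U u =ᵐ[volume.restrict U] G :=
  h.weakGrad.ae_eq hU h

/-! ### Sobolev functions -/

section Sobolev

variable {n : ℕ} {p : ℝ} {U : Set (Rn n)} {u v : Rn n → ℝ}

lemma MemW1p.hasWeakGrad (h : MemW1p p U u) : HasWeakGrad U u (weakGrad U u) := by
  obtain ⟨G, hG, -⟩ := h.2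
  exact hG.weakGrad

lemma MemW1p.memLp_weakGrad (hU : IsOpen U) (h : MemW1p p U u) :
    MemLp (weakGrad U u) (ENNReal.ofReal p) (volume.restrict U) := by
  obtain ⟨G, hG, hGp⟩ := h.2
  exact (memLp_congr_ae (hG.weakGrad_ae_eq hU)).2 hGp

lemma MemW1p.linComb (hu : MemW1p p U u) (hv : MemW1p p U v) (a b : ℝ) :
    MemW1p p U (fun x => a * u x + b * v x) := by
  obtain ⟨G, hG, hGp⟩ := hu.2
  obtain ⟨H, hH, hHp⟩ := hv.2
  exact ⟨(hu.1.const_mul a).add (hv.1.const_mul b), _, hG.linComb hH a b,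
    (hGp.const_smul a).add (hHp.const_smul b)⟩

lemma weakGrad_linComb (hU : IsOpen U) (hu : HasWeakGrad U u (weakGrad U u))
    (hv : HasWeakGrad U v (weakGrad U v)) (a b : ℝ) :
    weakGrad U (fun x => a * u x + b * v x) =ᵐ[volume.restrict U]
      fun x => a • weakGrad U u x + b • weakGrad U v x :=
  (hu.linComb hv a b).weakGrad_ae_eq hU

lemma eLpNorm_linComb_le {E : Type*} [NormedAddCommGroup E] [NormedSpace ℝ E] {μ : Measure (Rn n)}
    {q : ℝ≥0∞} (hq : 1 ≤ q) {f g : Rn n → E} (hf : AEStronglyMeasurable f μ)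
    (hg : AEStronglyMeasurable g μ) (a b : ℝ) :
    eLpNorm (fun x => a • f x + b • g x) q μ ≤ ‖a‖ₑ * eLpNorm f q μ + ‖b‖ₑ * eLpNorm g q μ := by
  refine (eLpNorm_add_le (hf.const_smul a) (hg.const_smul b) hq).trans ?_
  rw [eLpNorm_const_smul, eLpNorm_const_smul]

lemma VanishesOnBdry.linComb {Ω : Set (Rn n)} (hU : IsOpen U) (hp : 1 < p)
    (hu : VanishesOnBdry p Ω U u) (hv : VanishesOnBdry p Ω U v) (a b : ℝ) :
    VanishesOnBdry p Ω U (fun x => a * u x + b * v x) := by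
  refine ⟨hu.1.linComb hv.1 a b, fun δ hδ => ?_⟩
  have hp1 : 1 ≤ ENNReal.ofReal p := by simpa using hp.le
  obtain ⟨t, ht, ht0⟩ : ∃ t : ℝ≥0∞, ‖a‖ₑ * t + ‖b‖ₑ * t < δ ∧ 0 < t := by
    have h1 : Tendsto (fun t : ℝ≥0∞ => ‖a‖ₑ * t + ‖b‖ₑ * t) (𝓝 0) (𝓝 (‖a‖ₑ * 0 + ‖b‖ₑ * 0)) :=
      (ENNReal.Tendsto.const_mul tendsto_id (Or.inr enorm_ne_top)).add
        (ENNReal.Tendsto.const_mul tendsto_id (Or.inr enorm_ne_top))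
    simp only [mul_zero, add_zero] at h1
    have h2 := (h1.mono_left (nhdsWithin_le_nhds (s := Ioi 0))).eventually (gt_mem_nhds hδ)
    exact (h2.and self_mem_nhdsWithin).exists
  obtain ⟨ψ, hψ, hψc, hψs, hψδ⟩ := hu.2 t ht0
  obtain ⟨χ, hχ, hχc, hχs, hχδ⟩ := hv.2 t ht0
  refine ⟨fun x => a * ψ x + b * χ x, (contDiff_const.mul hψ).add (contDiff_const.mul hχ),
    (hψc.mul_left (f := fun _ => a)).add (hχc.mul_left (f := fun _ => b)), ?_, ?_⟩
  · refine (closure_minimal ?_ (isClosed_tsupport ψ |>.union (isClosed_tsupport χ))).trans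
      (union_subset hψs hχs)
    intro x hx
    by_contra hn
    rw [mem_union, not_or] at hn
    exact hx (by simp [image_eq_zero_of_notMem_tsupport hn.1,
      image_eq_zero_of_notMem_tsupport hn.2])
  · refine lt_of_le_of_lt ?_ ht
    have e1 : (fun x => (a * u x + b * v x) - (a * ψ x + b * χ x)) =
        fun x => a • (u x - ψ x) + b • (v x - χ x) := by
      ext x; simp only [smul_eq_mul]; ring
    have e2 : (fun x => weakGrad U (fun x => a * u x + b * v x) x -
        gradient (fun x => a * ψ x + b * χ x) x) =ᵐ[volume.restrict U]
        fun x => a • (weakGrad U u x - gradient ψ x) + b • (weakGrad U v x - gradient χ x) := by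
      filter_upwards [weakGrad_linComb hU hu.1.hasWeakGrad hv.1.hasWeakGrad a b] with x hx
      rw [hx, gradient_linComb hψ hχ]; module
    rw [e1, eLpNorm_congr_ae e2]
    have m1 : AEStronglyMeasurable (fun x => u x - ψ x) (volume.restrict U) :=
      hu.1.1.1.sub hψ.continuous.aestronglyMeasurable
    have m2 : AEStronglyMeasurable (fun x => v x - χ x) (volume.restrict U) :=
      hv.1.1.1.sub hχ.continuous.aestronglyMeasurable
    have m3 : AEStronglyMeasurable (fun x => weakGrad U u x - gradient ψ x) (volume.restrict U) :=
      (hu.1.memLp_weakGrad hU).1.sub (continuous_gradient hψ).aestronglyMeasurable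
    have m4 : AEStronglyMeasurable (fun x => weakGrad U v x - gradient χ x) (volume.restrict U) :=
      (hv.1.memLp_weakGrad hU).1.sub (continuous_gradient hχ).aestronglyMeasurable
    refine (add_le_add (eLpNorm_linComb_le hp1 m1 m2 a b)
      (eLpNorm_linComb_le hp1 m3 m4 a b)).trans ?_
    calc _ = ‖a‖ₑ * (eLpNorm (fun x => u x - ψ x) (ENNReal.ofReal p) (volume.restrict U) +
          eLpNorm (fun x => weakGrad U u x - gradient ψ x) (ENNReal.ofReal p)
            (volume.restrict U)) +
        ‖b‖ₑ * (eLpNorm (fun x => v x - χ x) (ENNReal.ofReal p) (volume.restrict U) +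
          eLpNorm (fun x => weakGrad U v x - gradient χ x) (ENNReal.ofReal p)
            (volume.restrict U)) := by ring
      _ ≤ _ := by gcongr

/-- The pointwise hypothesis `hw` reduces each later boundary-condition check to an identity for
`ring`; b = 0 serves when a single function is only rewritten. -/
lemma VanishesOnBdry.of_linComb {Ω : Set (Rn n)} (hU : IsOpen U) (hp : 1 < p)
    (hu : VanishesOnBdry p Ω U u) (hv : VanishesOnBdry p Ω U v) (a b : ℝ) {w : Rn n → ℝ}
    (hw : ∀ x, w x = a * u x + b * v x) : VanishesOnBdry p Ω U w := by
  rw [funext hw]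
  exact hu.linComb hU hp hv a b

end Sobolev

/-! ### Stability for Sobolev minimizers -/

lemma energy_congr {n : ℕ} {σ : Rn n → ℝ → ℝ} {U : Set (Rn n)} {G H : Rn n → Rn n}
    (h : G =ᵐ[volume.restrict U] H) : energy σ U G = energy σ U H :=
  lintegral_congr_ae (h.mono fun x hx => by simp only [hx])

/-- The stability theorem for Sobolev minimizers, with the minimality stated only for the three
competitors that matter. -/
theorem convergesInLp_weakGrad {n : ℕ} {p q : ℝ} (hp : 1 < p) (hq : 1 < q)
    {D U V : Set (Rn n)} (hD : IsOpen D) (hUD : U ⊆ D) (hVD : V ⊆ D)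
    (hbd : Bornology.IsBounded D) {σ : Rn n → ℝ → ℝ}
    (hU : IsUniformlyConvexDensity p U fun x X => energyDensity σ x ‖X‖)
    (hV : IsUniformlyConvexDensity q V fun x X => energyDensity σ x ‖X‖)
    {J : (Rn n → ℝ) → ℝ≥0∞}
    (hJ : ∀ v, J v = energy σ U (weakGrad D v) + energy σ V (weakGrad D v))
    {u₀ φ : Rn n → ℝ} {u : ℝ → Rn n → ℝ}
    (hu₀ : HasWeakGrad D u₀ (weakGrad D u₀)) (hφ : HasWeakGrad D φ (weakGrad D φ))
    (hu : ∀ ε, 0 < ε → HasWeakGrad D (u ε) (weakGrad D (u ε)))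
    (hfin : J u₀ < ⊤)
    (hφU : MemLp (weakGrad D φ) (ENNReal.ofReal p) (volume.restrict U))
    (hφV : MemLp (weakGrad D φ) (ENNReal.ofReal q) (volume.restrict V))
    (hmid : ∀ ε, 0 < ε → J (u ε) ≤
      J (fun x => (1 / 2) * u ε x + (1 / 2) * (1 * u₀ x + ε * φ x)))
    (hup : ∀ ε, 0 < ε → J (u ε) ≤ J (fun x => 1 * u₀ x + ε * φ x))
    (hdown : ∀ ε, 0 < ε → J u₀ ≤ J (fun x => 1 * u ε x + (-ε) * φ x)) :
    ConvergesInLp p U (fun ε => weakGrad D (u ε)) (weakGrad D u₀) ∧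
      ConvergesInLp q V (fun ε => weakGrad D (u ε)) (weakGrad D u₀) := by
  have fin : ∀ S, S ⊆ D → IsFiniteMeasure ((volume : Measure (Rn n)).restrict S) := fun S hS =>
    isFiniteMeasure_restrict.2 ((measure_mono hS).trans_lt hbd.measure_lt_top).ne
  have := fin U hUD
  have := fin V hVD
  have mU : ∀ {v}, HasWeakGrad D v (weakGrad D v) →
      AEStronglyMeasurable (weakGrad D v) (volume.restrict U) := fun h =>
    h.2.1.aestronglyMeasurable.mono_measure (Measure.restrict_mono hUD le_rfl)
  have mV : ∀ {v}, HasWeakGrad D v (weakGrad D v) →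
      AEStronglyMeasurable (weakGrad D v) (volume.restrict V) := fun h =>
    h.2.1.aestronglyMeasurable.mono_measure (Measure.restrict_mono hVD le_rfl)
  -- `weakGrad` is linear only almost everywhere. Energies ignore null sets, so the energy of a
  -- combination of functions may be computed from the combined gradients.
  have Jc : ∀ {v G}, weakGrad D v =ᵐ[volume.restrict D] G →
      J v = energy σ U G + energy σ V G := fun {v G} h => by
    rw [hJ, energy_congr (ae_restrict_of_ae_restrict_of_subset hUD h),
      energy_congr (ae_restrict_of_ae_restrict_of_subset hVD h)]
  have lin := fun (ε : ℝ) => weakGrad_linComb hD hu₀ hφ 1 ε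
  refine convergesInLp_of_minimality (Φ := weakGrad D φ) hp hq hU hV (mU hu₀) (mV hu₀)
    (by rwa [← hJ]) hφU hφV (fun ε hε => mU (hu ε hε)) (fun ε hε => mV (hu ε hε))
    (fun ε hε => ?_) (fun ε hε => ?_) (fun ε hε => ?_)
  · rw [← hJ]
    refine (hmid ε hε).trans_eq (Jc ?_)
    filter_upwards [weakGrad_linComb hD (hu ε hε) (hu₀.linComb hφ 1 ε).weakGrad (1 / 2) (1 / 2),
      lin ε] with x h1 h2
    rw [h1, h2]; module
  · rw [← hJ]
    refine (hup ε hε).trans_eq (Jc ?_)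
    filter_upwards [lin ε] with x h1
    rw [h1]; module
  · rw [← hJ]
    refine (hdown ε hε).trans_eq (Jc ?_)
    filter_upwards [weakGrad_linComb hD (hu ε hε) hφ 1 (-ε)] with x h1
    rw [h1]; module


/-! ### Lipschitz boundaries are null sets -/

lemma volume_graph_eq_zero {n : ℕ} {ν : Rn n} (hν : ‖ν‖ = 1) {γ : Rn n → ℝ} (hγ : Continuous γ) :
    volume {y : Rn n | γ (y - inner ℝ ν y • ν) = inner ℝ ν y} = 0 := by
  -- A translate along ν shifts the height but not the projection, so distinct translates of a graph
  -- are disjoint. The vectors ν/(k + 1) are infinitely many and bounded, which forces measure zero.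
  refine Measure.addHaar_eq_zero_of_disjoint_translates volume
    (fun k : ℕ => (1 / ((k : ℝ) + 1)) • ν) ?_ ?_ ?_
  · refine (Metric.isBounded_closedBall (x := (0 : Rn n)) (r := 1)).subset ?_
    rintro _ ⟨k, rfl⟩
    rw [mem_closedBall_zero_iff, norm_smul, hν, mul_one, Real.norm_of_nonneg (by positivity),
      div_le_one (by positivity)]
    linarith [(k.cast_nonneg : (0 : ℝ) ≤ k)]
  · intro i j hij
    refine Set.disjoint_left.2 fun z hz hz' => hij ?_
    simp only [singleton_add, mem_image] at hz hz'
    obtain ⟨y, hy, rfl⟩ := hz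
    obtain ⟨y', hy', he⟩ := hz'
    have hνν : inner ℝ ν ν = 1 := by rw [real_inner_self_eq_norm_sq, hν]; norm_num
    set a : ℝ := 1 / ((i : ℝ) + 1) with ha
    set b : ℝ := 1 / ((j : ℝ) + 1) with hb
    have hyy : y' = y + (a - b) • ν := by
      have : y' = (a • ν + y) - b • ν := by rw [← he]; abel
      rw [this]; module
    have hin : inner ℝ ν y' = inner ℝ ν y + (a - b) := by
      rw [hyy, inner_add_right, real_inner_smul_right, hνν, mul_one]
    have hproj : y' - inner ℝ ν y' • ν = y - inner ℝ ν y • ν := by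
      rw [hin, hyy]; module
    simp only [mem_ofPred_eq] at hy hy'
    rw [hproj, hy, hin] at hy'
    have hab : a = b := by linarith
    rw [ha, hb, one_div, one_div, inv_inj] at hab
    exact_mod_cast (add_right_cancel hab)
  · exact (isClosed_eq (by fun_prop) (by fun_prop)).measurableSet

/-- A Lipschitz boundary is a Lebesgue null set. -/
lemma HasLipschitzBoundary.volume_frontier_eq_zero {n : ℕ} {U : Set (Rn n)}
    (h : HasLipschitzBoundary U) : volume (frontier U) = 0 := by
  refine measure_null_of_locally_null _ fun x hx => ?_
  obtain ⟨ν, r, K, γ, hν, hr, hγ, hU⟩ := h x hx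
  refine ⟨frontier U ∩ Metric.ball x r,
    inter_mem_nhdsWithin _ (Metric.ball_mem_nhds x hr),
    measure_mono_null ?_ (volume_graph_eq_zero hν hγ.continuous)⟩
  rintro y ⟨hyf, hyb⟩
  have hc := hγ.continuous
  have c1 : Continuous fun y : Rn n => γ (y - inner ℝ ν y • ν) := by fun_prop
  have c2 : Continuous fun y : Rn n => inner ℝ ν y := by fun_prop
  have hball : Metric.ball x r ∈ 𝓝 y := Metric.isOpen_ball.mem_nhds hyb
  rcases lt_trichotomy (γ (y - inner ℝ ν y • ν)) (inner ℝ ν y) with hlt | heq | hgt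
  · exfalso
    have hint : y ∈ interior U := by
      rw [mem_interior_iff_mem_nhds]
      filter_upwards [hball, (isOpen_lt c1 c2).mem_nhds hlt] with z hz hzl
      exact (hU z hz).2 hzl
    exact hyf.2 hint
  · exact heq
  · exfalso
    have hext : Uᶜ ∈ 𝓝 y := by
      filter_upwards [hball, (isOpen_lt c2 c1).mem_nhds hgt] with z hz hzl hzU
      exact lt_asymm hzl ((hU z hz).1 hzU)
    exact (mem_closure_iff_nhds.1 hyf.1 _ hext).elim fun z hz => hz.1 hz.2

/-! ### Gluing convergence over two regions -/

lemma eLpNorm_le_add_of_ae_mem_union {X E : Type*} [MeasurableSpace X] [NormedAddCommGroup E]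
    {μ : Measure X} {q : ℝ≥0∞} (hq : 1 ≤ q) {S T : Set X} (hS : MeasurableSet S)
    (hT : MeasurableSet T) (hST : ∀ᵐ x ∂μ, x ∈ S ∪ T) {f : X → E}
    (hf : AEStronglyMeasurable f μ) :
    eLpNorm f q μ ≤ eLpNorm f q (μ.restrict S) + eLpNorm f q (μ.restrict T) := by
  have e : f =ᵐ[μ] S.indicator f + (T \ S).indicator f := by
    filter_upwards [hST] with x hx
    by_cases h : x ∈ S
    · simp [h]
    · simp [h, hx.resolve_left h]
  rw [eLpNorm_congr_ae e]
  refine (eLpNorm_add_le (hf.indicator hS) (hf.indicator (hT.diff hS)) hq).trans ?_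
  rw [eLpNorm_indicator_eq_eLpNorm_restrict hS,
    eLpNorm_indicator_eq_eLpNorm_restrict (hT.diff hS)]
  exact add_le_add le_rfl (eLpNorm_mono_measure f (Measure.restrict_mono sdiff_subset le_rfl))

/-- Convergence with exponents `p` and `q` in two pieces gives convergence with exponent
`min p q` in the union. -/
lemma ConvergesInLp.union {n : ℕ} {p q : ℝ} (hp : 1 < p) (hq : 1 < q) {D S T : Set (Rn n)}
    (hbd : Bornology.IsBounded D) (hS : MeasurableSet S) (hT : MeasurableSet T)
    (hSD : S ⊆ D) (hTD : T ⊆ D) (hST : ∀ᵐ x ∂(volume.restrict D), x ∈ S ∪ T)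
    {G : ℝ → Rn n → Rn n} {G₀ : Rn n → Rn n}
    (hG₀ : AEStronglyMeasurable G₀ (volume.restrict D))
    (hG : ∀ ε, 0 < ε → AEStronglyMeasurable (G ε) (volume.restrict D))
    (h1 : ConvergesInLp p S G G₀) (h2 : ConvergesInLp q T G G₀) :
    ConvergesInLp (min p q) D G G₀ := by
  have hm1 : 1 ≤ ENNReal.ofReal (min p q) := by simpa using ⟨hp.le, hq.le⟩
  have fin : ∀ S, S ⊆ D → IsFiniteMeasure ((volume : Measure (Rn n)).restrict S) := fun S hS =>
    isFiniteMeasure_restrict.2 ((measure_mono hS).trans_lt hbd.measure_lt_top).ne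
  have := fin S hSD
  have := fin T hTD
  have hpm : ENNReal.ofReal (min p q) ≤ ENNReal.ofReal p :=
    ENNReal.ofReal_le_ofReal (min_le_left _ _)
  have hqm : ENNReal.ofReal (min p q) ≤ ENNReal.ofReal q :=
    ENNReal.ofReal_le_ofReal (min_le_right _ _)
  have split : ∀ f : Rn n → Rn n, AEStronglyMeasurable f (volume.restrict D) →
      eLpNorm f (ENNReal.ofReal (min p q)) (volume.restrict D) ≤
        eLpNorm f (ENNReal.ofReal (min p q)) (volume.restrict S) +
        eLpNorm f (ENNReal.ofReal (min p q)) (volume.restrict T) := fun f hf => by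
    have := eLpNorm_le_add_of_ae_mem_union hm1 hS hT hST hf
    rwa [Measure.restrict_restrict hS, Measure.restrict_restrict hT,
      inter_eq_left.2 hSD, inter_eq_left.2 hTD] at this
  have mem : ∀ f : Rn n → Rn n, AEStronglyMeasurable f (volume.restrict D) →
      MemLp f (ENNReal.ofReal p) (volume.restrict S) →
      MemLp f (ENNReal.ofReal q) (volume.restrict T) →
      MemLp f (ENNReal.ofReal (min p q)) (volume.restrict D) := fun f hf f1 f2 =>
    ⟨hf, (split f hf).trans_lt (ENNReal.add_lt_top.2
      ⟨(f1.mono_exponent hpm).2, (f2.mono_exponent hqm).2⟩)⟩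
  refine ⟨mem _ hG₀ h1.1 h2.1, fun ε hε => mem _ (hG ε hε) (h1.2.1 ε hε) (h2.2.1 ε hε), ?_⟩
  have key : ∀ {s : ℝ} {A : Set (Rn n)}, 1 < s → A ⊆ D →
      ENNReal.ofReal (min p q) ≤ ENNReal.ofReal s → ConvergesInLp s A G G₀ →
      Tendsto (fun ε => eLpNorm (fun x => G ε x - G₀ x) (ENNReal.ofReal (min p q))
        (volume.restrict A)) (𝓝[>] 0) (𝓝 0) := by
    intro s A hs hAD hle hA
    have := fin A hAD
    -- The Hölder constant of the inclusion of L^s in L^min(p,q) on a set of finite measure; it is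
    -- finite because its exponent is nonnegative.
    set c := volume.restrict A univ ^
      (1 / (ENNReal.ofReal (min p q)).toReal - 1 / (ENNReal.ofReal s).toReal)
    have hc : c ≠ ⊤ := by
      refine ENNReal.rpow_ne_top_of_nonneg ?_ (measure_ne_top _ _)
      rw [sub_nonneg]
      refine one_div_le_one_div_of_le ?_ (ENNReal.toReal_mono ENNReal.ofReal_ne_top hle)
      rw [ENNReal.toReal_ofReal (by positivity)]
      positivity
    have lim := ENNReal.Tendsto.mul_const hA.2.2 (b := c) (Or.inr hc)
    rw [zero_mul] at lim
    refine tendsto_of_tendsto_of_tendsto_of_le_of_le' tendsto_const_nhds lim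
      (Eventually.of_forall fun _ => zero_le) ?_
    filter_upwards [self_mem_nhdsWithin] with ε hε
    exact eLpNorm_le_eLpNorm_mul_rpow_measure_univ hle ((hA.2.1 ε hε).sub hA.1).1
  have lim := (key hp hSD hpm h1).add (key hq hTD hqm h2)
  rw [add_zero] at lim
  refine tendsto_of_tendsto_of_tendsto_of_le_of_le' tendsto_const_nhds lim
    (Eventually.of_forall fun _ => zero_le) ?_
  filter_upwards [self_mem_nhdsWithin] with ε hε
  exact split _ ((hG ε hε).sub hG₀)


/-! ### Mollification -/

section Mollify

variable {n : ℕ} {E : Type*} [NormedAddCommGroup E] [NormedSpace ℝ E]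

/-- Convolution with a normalised smooth bump function. -/
def mollify (φ : ContDiffBump (0 : Rn n)) (g : Rn n → E) : Rn n → E :=
  convolution (φ.normed volume) g (ContinuousLinearMap.lsmul ℝ ℝ) volume

lemma mollify_apply (φ : ContDiffBump (0 : Rn n)) (g : Rn n → E) (x : Rn n) :
    mollify φ g x = ∫ t, φ.normed volume t • g (x - t) := convolution_lsmul

lemma mollify_apply_swap (φ : ContDiffBump (0 : Rn n)) (g : Rn n → E) (x : Rn n) :
    mollify φ g x = ∫ t, φ.normed volume (x - t) • g t := convolution_lsmul_swap

lemma mollify_congr (φ : ContDiffBump (0 : Rn n)) {g h : Rn n → E} (hgh : g =ᵐ[volume] h) :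
    mollify φ g = mollify φ h := convolution_congr _ (ae_eq_refl _) hgh

lemma contDiff_mollify (φ : ContDiffBump (0 : Rn n)) {g : Rn n → E}
    (hg : LocallyIntegrable g) : ContDiff ℝ 1 (mollify φ g) :=
  HasCompactSupport.contDiff_convolution_left (n := 1) (f := φ.normed volume) (μ := volume)
    _ φ.hasCompactSupport_normed φ.contDiff_normed hg

lemma mollify_sub (φ : ContDiffBump (0 : Rn n)) {g h : Rn n → E}
    (hg : LocallyIntegrable g) (hh : LocallyIntegrable h) :
    mollify φ (fun x => g x - h x) = fun x => mollify φ g x - mollify φ h x := by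
  ext x
  have e1 := (φ.hasCompactSupport_normed (μ := volume)).convolutionExists_left (μ := volume)
    (ContinuousLinearMap.lsmul ℝ ℝ (E := E)) φ.continuous_normed hg x
  have e2 := (φ.hasCompactSupport_normed (μ := volume)).convolutionExists_left (μ := volume)
    (ContinuousLinearMap.lsmul ℝ ℝ (E := E)) φ.continuous_normed hh x
  simp only [mollify_apply, smul_sub]
  exact integral_sub e1 e2

lemma support_mollify_subset (φ : ContDiffBump (0 : Rn n)) (g : Rn n → E) :
    Function.support (mollify φ g) ⊆ Metric.cthickening φ.rOut (tsupport g) := by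
  intro x hx
  obtain ⟨a, ha, b, hb, rfl⟩ := support_convolution_subset_swap _ hx
  rw [φ.support_normed_eq, mem_ball_zero_iff] at hb
  refine Metric.mem_cthickening_of_dist_le (a + b) a _ _ (subset_tsupport g ha) ?_
  simpa using hb.le

lemma tsupport_mollify_subset (φ : ContDiffBump (0 : Rn n)) (g : Rn n → E) :
    tsupport (mollify φ g) ⊆ Metric.cthickening φ.rOut (tsupport g) :=
  closure_minimal (support_mollify_subset φ g) Metric.isClosed_cthickening

lemma hasCompactSupport_mollify (φ : ContDiffBump (0 : Rn n)) {g : Rn n → E}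
    (hg : HasCompactSupport g) : HasCompactSupport (mollify φ g) :=
  (IsCompact.cthickening hg).of_isClosed_subset (isClosed_tsupport _)
    (tsupport_mollify_subset φ g)

/-- Mollification is a contraction of `L^p`. -/
lemma eLpNorm_mollify_le (φ : ContDiffBump (0 : Rn n)) {p : ℝ} (hp : 1 ≤ p) {h : Rn n → E}
    (hh : AEStronglyMeasurable h volume) :
    eLpNorm (mollify φ h) (ENNReal.ofReal p) volume ≤ eLpNorm h (ENNReal.ofReal p) volume := by
  wlog hs : StronglyMeasurable h generalizing h
  · rw [mollify_congr φ hh.ae_eq_mk, eLpNorm_congr_ae hh.ae_eq_mk]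
    exact this hh.stronglyMeasurable_mk.aestronglyMeasurable hh.stronglyMeasurable_mk
  have hp0 : 0 < p := by linarith
  set w : Rn n → ℝ≥0∞ := fun t => ENNReal.ofReal (φ.normed volume t) with hw
  have hwm : Measurable w := φ.continuous_normed.measurable.ennreal_ofReal
  have hw1 : ∫⁻ t, w t = 1 := by
    rw [hw, ← ofReal_integral_eq_lintegral_ofReal φ.integrable_normed
      (Eventually.of_forall fun t => φ.nonneg_normed t), φ.integral_normed, ENNReal.ofReal_one]
  -- Viewing the kernel as a probability measure turns Jensen's inequality into monotonicity of L^p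
  -- norms in the exponent. Tonelli and translation invariance then finish.
  set P : Measure (Rn n) := volume.withDensity w
  have : IsProbabilityMeasure P := ⟨by
    rw [withDensity_apply _ MeasurableSet.univ, Measure.restrict_univ, hw1]⟩
  have hem : Measurable fun z => ‖h z‖ₑ := hs.enorm
  have pt : ∀ x, ‖mollify φ h x‖ₑ ^ p ≤ ∫⁻ t, w t * ‖h (x - t)‖ₑ ^ p := by
    intro x
    have hsx : StronglyMeasurable fun t => h (x - t) :=
      hs.comp_measurable (measurable_const.sub measurable_id)
    have a1 : ‖mollify φ h x‖ₑ ≤ eLpNorm (fun t => h (x - t)) 1 P := by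
      rw [eLpNorm_one_eq_lintegral_enorm, lintegral_withDensity_eq_lintegral_mul _ hwm hsx.enorm,
        mollify_apply]
      refine (enorm_integral_le_lintegral_enorm _).trans_eq (lintegral_congr fun t => ?_)
      rw [enorm_smul, Real.enorm_of_nonneg (φ.nonneg_normed t)]
      rfl
    have a2 : eLpNorm (fun t => h (x - t)) 1 P ≤
        eLpNorm (fun t => h (x - t)) (ENNReal.ofReal p) P :=
      eLpNorm_le_eLpNorm_of_exponent_le (by simpa using hp) hsx.aestronglyMeasurable
    refine (ENNReal.rpow_le_rpow (a1.trans a2) hp0.le).trans_eq ?_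
    rw [eLpNorm_eq_lintegral_rpow_enorm_toReal (by simpa using hp0) ENNReal.ofReal_ne_top,
      ENNReal.toReal_ofReal hp0.le, ← ENNReal.rpow_mul, one_div_mul_cancel hp0.ne',
      ENNReal.rpow_one, lintegral_withDensity_eq_lintegral_mul _ hwm (hsx.enorm.pow_const p)]
    rfl
  rw [eLpNorm_eq_lintegral_rpow_enorm_toReal (by simpa using hp0) ENNReal.ofReal_ne_top,
    eLpNorm_eq_lintegral_rpow_enorm_toReal (by simpa using hp0) ENNReal.ofReal_ne_top,
    ENNReal.toReal_ofReal hp0.le]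
  refine ENNReal.rpow_le_rpow ?_ (by positivity)
  calc ∫⁻ x, ‖mollify φ h x‖ₑ ^ p ≤ ∫⁻ x, ∫⁻ t, w t * ‖h (x - t)‖ₑ ^ p := lintegral_mono pt
    _ = ∫⁻ t, ∫⁻ x, w t * ‖h (x - t)‖ₑ ^ p := by
        refine lintegral_lintegral_swap (Measurable.aemeasurable ?_)
        exact (hwm.comp measurable_snd).mul
          ((hem.comp (measurable_fst.sub measurable_snd)).pow_const p)
    _ = ∫⁻ t, w t * ∫⁻ x, ‖h x‖ₑ ^ p := by
        refine lintegral_congr fun t => ?_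
        have hm : Measurable fun x => ‖h (x - t)‖ₑ ^ p :=
          (hem.comp (measurable_id.sub measurable_const)).pow_const p
        rw [lintegral_const_mul _ hm]
        congr 1
        exact lintegral_sub_right_eq_self (fun x => ‖h x‖ₑ ^ p) t
    _ = ∫⁻ x, ‖h x‖ₑ ^ p := by
        rw [lintegral_mul_const _ hwm, hw1, one_mul]

/-- Uniform continuity makes the difference uniformly small, and for radii below 1 it is supported
in one fixed compact set. -/
lemma exists_eLpNorm_mollify_sub_le_of_continuous [CompleteSpace E] {p : ℝ} {g : Rn n → E}
    (hg : Continuous g) (hgc : HasCompactSupport g) {δ : ℝ≥0∞} (hδ : 0 < δ) :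
    ∃ η : ℝ, 0 < η ∧ ∀ φ : ContDiffBump (0 : Rn n), φ.rOut < η →
      eLpNorm (mollify φ g - g) (ENNReal.ofReal p) volume ≤ δ := by
  set S := Metric.cthickening 1 (tsupport g)
  have hS : IsCompact S := IsCompact.cthickening hgc
  obtain ⟨c, hc0, hc⟩ : ∃ c : ℝ, 0 < c ∧
      ENNReal.ofReal c * volume S ^ (1 / (ENNReal.ofReal p).toReal) ≤ δ := by
    have hfin : volume S ^ (1 / (ENNReal.ofReal p).toReal) ≠ ⊤ :=
      ENNReal.rpow_ne_top_of_nonneg (by positivity) hS.measure_lt_top.ne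
    have h0 : Tendsto (fun c : ℝ => ENNReal.ofReal c) (𝓝[>] 0) (𝓝 0) := by
      simpa using ENNReal.tendsto_ofReal
        ((tendsto_id (α := ℝ) (x := 𝓝 0)).mono_left (nhdsWithin_le_nhds (s := Ioi 0)))
    have h1 := ENNReal.Tendsto.mul_const h0 (Or.inr hfin)
    rw [zero_mul] at h1
    obtain ⟨c, hc, hc0⟩ := ((h1.eventually (gt_mem_nhds hδ)).and self_mem_nhdsWithin).exists
    exact ⟨c, hc0, hc.le⟩
  obtain ⟨η, hη, hu⟩ := Metric.uniformContinuous_iff.1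
    (hgc.uniformContinuous_of_continuous hg) c hc0
  refine ⟨min η 1, by positivity, fun φ hφ => ?_⟩
  refine (eLpNorm_sub_le_of_dist_bdd volume ENNReal.ofReal_ne_top hS.measurableSet hc0.le
    (fun x => ?_) ?_ ?_).trans hc
  · refine φ.dist_normed_convolution_le hg.aestronglyMeasurable fun y hy => ?_
    exact (hu (lt_of_lt_of_le (lt_trans hy hφ) (min_le_left _ _))).le
  · exact (support_mollify_subset φ g).trans
      (Metric.cthickening_mono (hφ.le.trans (min_le_right _ _)) _)
  · exact (subset_tsupport g).trans (Metric.self_subset_cthickening _)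

/-- Mollifications converge in `L^p`. -/
lemma exists_eLpNorm_mollify_sub_le [CompleteSpace E] {p : ℝ} (hp : 1 ≤ p) {h : Rn n → E}
    (hh : MemLp h (ENNReal.ofReal p) volume) {δ : ℝ≥0∞} (hδ : 0 < δ) :
    ∃ η : ℝ, 0 < η ∧ ∀ φ : ContDiffBump (0 : Rn n), φ.rOut < η →
      eLpNorm (mollify φ h - h) (ENNReal.ofReal p) volume ≤ δ := by
  have hp1 : 1 ≤ ENNReal.ofReal p := by simpa using hp
  have hδ3 : 0 < δ / 3 := ENNReal.div_pos hδ.ne' (by norm_num)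
  obtain ⟨g, hgc, hg, hgcont, hgp⟩ :=
    hh.exists_hasCompactSupport_eLpNorm_sub_le ENNReal.ofReal_ne_top hδ3.ne'
  obtain ⟨η, hη, hu⟩ := exists_eLpNorm_mollify_sub_le_of_continuous (p := p) hgcont hgc hδ3
  refine ⟨η, hη, fun φ hφ => ?_⟩
  have lh := hh.locallyIntegrable hp1
  have lg := hgp.locallyIntegrable hp1
  -- For the approximation g of h, the first and last terms are small because mollification is a
  -- contraction, the middle one because g is continuous with compact support.
  have e : mollify φ h - h = mollify φ (h - g) + (mollify φ g - g) - (h - g) := by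
    have := mollify_sub φ lh lg
    ext x
    have hx : mollify φ (h - g) x = mollify φ h x - mollify φ g x := congrFun this x
    simp only [Pi.sub_apply, Pi.add_apply, hx]
    abel
  have lhg : LocallyIntegrable (h - g) volume := lh.sub lg
  have m1 : AEStronglyMeasurable (mollify φ (h - g)) volume :=
    (contDiff_mollify φ lhg).continuous.aestronglyMeasurable
  have m2 : AEStronglyMeasurable (mollify φ g - g) volume :=
    ((contDiff_mollify φ lg).continuous.sub hgcont).aestronglyMeasurable
  rw [e]
  calc _ ≤ eLpNorm (mollify φ (h - g)) (ENNReal.ofReal p) volume +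
        eLpNorm (mollify φ g - g) (ENNReal.ofReal p) volume +
        eLpNorm (h - g) (ENNReal.ofReal p) volume :=
        (eLpNorm_sub_le (m1.add m2) (hh.sub hgp).1 hp1).trans
          (add_le_add (eLpNorm_add_le m1 m2 hp1) le_rfl)
    _ ≤ δ / 3 + δ / 3 + δ / 3 :=
        add_le_add (add_le_add ((eLpNorm_mollify_le φ hp (hh.sub hgp).1).trans hg) (hu φ hφ)) hg
    _ = δ := ENNReal.add_thirds δ

end Mollify

/-- Mollification commutes with weak differentiation. -/
lemma gradient_mollify {n : ℕ} (φ : ContDiffBump (0 : Rn n)) {w : Rn n → ℝ} {W : Rn n → Rn n}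
    (h : HasWeakGrad univ w W) (x : Rn n) : gradient (mollify φ w) x = mollify φ W x := by
  set ρ := φ.normed volume with hρ
  have hw : LocallyIntegrable w := locallyIntegrableOn_univ.1 h.1
  have hρ1 : ContDiff ℝ 1 ρ := φ.contDiff_normed (n := 1)
  have hρ2 : ContDiff ℝ ∞ ρ := φ.contDiff_normed (n := ⊤)
  have hd := φ.hasCompactSupport_normed.hasFDerivAt_convolution_left
    (ContinuousLinearMap.lsmul ℝ ℝ) hρ1 hw x
  -- The reflected kernel is the test function. Its gradient has the opposite sign, which cancels
  -- the minus sign in the definition of the weak gradient.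
  set ψ : Rn n → ℝ := fun t => ρ (x - t) with hψ
  have hψs : ContDiff ℝ ∞ ψ := hρ2.comp (contDiff_const.sub contDiff_id)
  have hψc : HasCompactSupport ψ :=
    φ.hasCompactSupport_normed.comp_homeomorph (Homeomorph.subLeft x)
  have hψg : ∀ t, gradient ψ t = -gradient ρ (x - t) := fun t => by
    have h1 : HasFDerivAt ψ ((fderiv ℝ ρ (x - t)).comp (-ContinuousLinearMap.id ℝ (Rn n))) t :=
      (hρ1.differentiable one_ne_zero (x - t)).hasFDerivAt.comp t ((hasFDerivAt_id t).const_sub x)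
    rw [gradient_eq_toDual, gradient_eq_toDual, h1.fderiv]
    simp
  have key := h.2.2 ψ hψs hψc (subset_univ _)
  rw [Measure.restrict_univ] at key
  rw [mollify_apply_swap, gradient_eq_toDual]
  have hfd : fderiv ℝ (mollify φ w) x = ∫ t, w t • fderiv ℝ ρ (x - t) := by
    rw [show fderiv ℝ (mollify φ w) x = _ from hd.fderiv, convolution_eq_swap]
    refine integral_congr_ae (Eventually.of_forall fun t => ?_)
    ext v
    simp [ContinuousLinearMap.precompL_apply, mul_comm, hρ]
  rw [hfd]
  have hcomm := ((InnerProductSpace.toDual ℝ (Rn n)).symm.toContinuousLinearEquiv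
    |>.integral_comp_comm (μ := volume) (fun t => w t • fderiv ℝ ρ (x - t)))
  have e : (∫ t, w t • gradient ψ t) =
      -(InnerProductSpace.toDual ℝ (Rn n)).symm (∫ t, w t • fderiv ℝ ρ (x - t)) := by
    refine Eq.trans ?_ (congrArg Neg.neg hcomm)
    rw [← integral_neg]
    refine integral_congr_ae (Eventually.of_forall fun t => ?_)
    simp [hψg, gradient_eq_toDual]
  rw [e, neg_inj] at key
  exact key


/-! ### Cutting off Sobolev functions -/

lemma exists_smooth_cutoff {n : ℕ} {K U : Set (Rn n)} (hK : IsCompact K) (hU : IsOpen U)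
    (hKU : K ⊆ U) : ∃ χ : Rn n → ℝ, ContDiff ℝ ∞ χ ∧ HasCompactSupport χ ∧ tsupport χ ⊆ U ∧
      ∀ x ∈ K, χ x = 1 := by
  obtain ⟨δ, hδ, hsub⟩ := hK.exists_cthickening_subset_open hU hKU
  obtain ⟨χ, hχ, -, hsupp, hone⟩ := exists_contMDiff_support_eq_eq_one_iff
    (modelWithCornersSelf ℝ (Rn n)) (n := ⊤)
    (Metric.isOpen_thickening (δ := δ) (E := K)) hK.isClosed
    (Metric.self_subset_thickening hδ K)
  have ht : tsupport χ ⊆ Metric.cthickening δ K := by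
    rw [tsupport, hsupp]
    exact Metric.closure_thickening_subset_cthickening δ K
  exact ⟨χ, hχ.contDiff, hK.cthickening.of_isClosed_subset (isClosed_tsupport _) ht,
    ht.trans hsub, fun x hx => (hone x).1 hx⟩

section Cutoff

variable {n : ℕ} {Ω : Set (Rn n)} {f χ : Rn n → ℝ} {F : Rn n → Rn n}

/-- Since χψ is a test function in Ω for any test function ψ on the whole space, the Leibniz rule
χ∇ψ = ∇(χψ) - ψ∇χ reduces the claim to the weak gradient of f. Extension by zero is harmless because
χ is supported inside Ω. -/
lemma HasWeakGrad.cutoff (hΩ : IsOpen Ω) (hf : HasWeakGrad Ω f F) (hχ : ContDiff ℝ ∞ χ)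
    (hc : HasCompactSupport χ) (hs : tsupport χ ⊆ Ω)
    (hw : LocallyIntegrable fun x => χ x * f x)
    (hW : LocallyIntegrable fun x => χ x • F x + f x • gradient χ x) :
    HasWeakGrad univ (fun x => χ x * f x) (fun x => χ x • F x + f x • gradient χ x) := by
  refine ⟨hw.locallyIntegrableOn _, hW.locallyIntegrableOn _, fun ψ hψ hψc _ => ?_⟩
  have hχ1 : ContDiff ℝ 1 χ := hχ.of_le (by exact_mod_cast le_top)
  have hψ1 : ContDiff ℝ 1 ψ := hψ.of_le (by exact_mod_cast le_top)
  have hzero : ∀ x ∉ Ω, χ x = 0 := fun x hx =>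
    image_eq_zero_of_notMem_tsupport fun h => hx (hs h)
  have hgzero : ∀ x ∉ Ω, gradient χ x = 0 := fun x hx =>
    gradient_eq_zero_of_notMem_tsupport fun h => hx (hs h)
  have hsp : tsupport (fun x => χ x * ψ x) ⊆ Ω := (tsupport_mul_subset_left).trans hs
  have hcp : HasCompactSupport (fun x => χ x * ψ x) := hc.mul_right
  have key := hf.2.2 (fun x => χ x * ψ x) (hχ.mul hψ) hcp hsp
  have i1 := integrableOn_smul_gradient hf.1 (hχ1.mul hψ1) hcp hsp
  have lψ : LocallyIntegrableOn (fun x => ψ x * f x) Ω :=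
    hf.1.continuousOn_smul hΩ.isLocallyClosed hψ.continuous.continuousOn
  have i2 := integrableOn_smul_gradient lψ hχ1 hc hs
  have i3 := integrableOn_smul_of_tsupport hf.2.1 (hχ.mul hψ).continuous hcp hsp
  simp only [Measure.restrict_univ]
  have eL : ∫ x, (χ x * f x) • gradient ψ x = ∫ x in Ω, (χ x * f x) • gradient ψ x :=
    (setIntegral_eq_integral_of_forall_compl_eq_zero fun x hx => by simp [hzero x hx]).symm
  have eR : ∫ x, ψ x • (χ x • F x + f x • gradient χ x) =
      ∫ x in Ω, ψ x • (χ x • F x + f x • gradient χ x) :=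
    (setIntegral_eq_integral_of_forall_compl_eq_zero fun x hx => by
      simp [hzero x hx, hgzero x hx]).symm
  rw [eL, eR]
  have e1 : ∀ x, (χ x * f x) • gradient ψ x =
      f x • gradient (fun y => χ y * ψ y) x - (ψ x * f x) • gradient χ x := fun x => by
    rw [gradient_mul hχ1 hψ1]; module
  have e2 : ∀ x, ψ x • (χ x • F x + f x • gradient χ x) =
      (χ x * ψ x) • F x + (ψ x * f x) • gradient χ x := fun x => by module
  simp only [e1, e2]
  rw [integral_sub i1 i2, integral_add i3 i2, key]
  abel

lemma memLp_cutoff (hΩ : IsOpen Ω) {q : ℝ≥0∞} (hf : MemLp f q (volume.restrict Ω))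
    (hχ : Continuous χ) (hc : HasCompactSupport χ) (hs : tsupport χ ⊆ Ω) :
    MemLp (fun x => χ x * f x) q volume := by
  obtain ⟨C, hC⟩ := hχ.bounded_above_of_compact_support hc
  have h1 : MemLp (fun x => χ x * f x) q (volume.restrict Ω) :=
    hf.of_le_mul (c := C) (hχ.aestronglyMeasurable.mul hf.1) (Eventually.of_forall fun x => by
      rw [norm_mul]; exact mul_le_mul_of_nonneg_right (hC x) (norm_nonneg _))
  rw [← memLp_indicator_iff_restrict hΩ.measurableSet] at h1
  refine (memLp_congr_ae (Eventually.of_forall fun x => ?_)).1 h1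
  by_cases hx : x ∈ Ω
  · simp [hx]
  · simp [hx, image_eq_zero_of_notMem_tsupport fun h => hx (hs h)]

lemma memLp_cutoff_grad (hΩ : IsOpen Ω) {q : ℝ≥0∞} (hf : MemLp f q (volume.restrict Ω))
    (hF : MemLp F q (volume.restrict Ω)) (hχ : ContDiff ℝ 1 χ) (hc : HasCompactSupport χ)
    (hs : tsupport χ ⊆ Ω) :
    MemLp (fun x => χ x • F x + f x • gradient χ x) q volume := by
  obtain ⟨C, hC⟩ := hχ.continuous.bounded_above_of_compact_support hc
  have hgc : HasCompactSupport (gradient χ) := hc.of_isClosed_subset (isClosed_tsupport _)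
    (closure_minimal (fun x hx => by
      by_contra hn
      exact hx (gradient_eq_zero_of_notMem_tsupport hn)) (isClosed_tsupport _))
  obtain ⟨D, hD⟩ := (continuous_gradient hχ).bounded_above_of_compact_support hgc
  have h1 : MemLp (fun x => χ x • F x) q (volume.restrict Ω) :=
    hF.of_le_mul (c := C) (hχ.continuous.aestronglyMeasurable.smul hF.1)
      (Eventually.of_forall fun x => by
        rw [norm_smul]; exact mul_le_mul_of_nonneg_right (hC x) (norm_nonneg _))
  have h2 : MemLp (fun x => f x • gradient χ x) q (volume.restrict Ω) :=
    hf.of_le_mul (c := D) (hf.1.smul (continuous_gradient hχ).aestronglyMeasurable)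
      (Eventually.of_forall fun x => by
        rw [norm_smul, mul_comm]; exact mul_le_mul_of_nonneg_right (hD x) (norm_nonneg _))
  have h3 := h1.add h2
  rw [← memLp_indicator_iff_restrict hΩ.measurableSet] at h3
  refine (memLp_congr_ae (Eventually.of_forall fun x => ?_)).1 h3
  by_cases hx : x ∈ Ω
  · simp [hx]
  · simp [hx, image_eq_zero_of_notMem_tsupport fun h => hx (hs h),
      gradient_eq_zero_of_notMem_tsupport fun h => hx (hs h)]

/-- A compactly supported cutoff of a Sobolev function lies in `W₀^{1,p}`. -/
lemma memW01p_cutoff (hΩ : IsOpen Ω) {p : ℝ} (hp : 1 < p) (hf : MemW1p p Ω f)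
    (hχ : ContDiff ℝ ∞ χ) (hc : HasCompactSupport χ) (hs : tsupport χ ⊆ Ω) :
    MemW01p p Ω (fun x => χ x * f x) ∧
      weakGrad Ω (fun x => χ x * f x) =ᵐ[volume.restrict Ω]
        fun x => χ x • weakGrad Ω f x + f x • gradient χ x := by
  have hp1 : 1 ≤ ENNReal.ofReal p := by simpa using hp.le
  have hχ1 : ContDiff ℝ 1 χ := hχ.of_le (by exact_mod_cast le_top)
  have mw := memLp_cutoff hΩ hf.1 hχ.continuous hc hs
  have mW := memLp_cutoff_grad hΩ hf.1 (hf.memLp_weakGrad hΩ) hχ1 hc hs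
  set w : Rn n → ℝ := fun x => χ x * f x
  set W : Rn n → Rn n := fun x => χ x • weakGrad Ω f x + f x • gradient χ x
  have lw : LocallyIntegrable w := mw.locallyIntegrable hp1
  have hg : HasWeakGrad univ w W :=
    hf.hasWeakGrad.cutoff hΩ hχ hc hs lw (mW.locallyIntegrable hp1)
  have hgΩ : HasWeakGrad Ω w W := hg.mono (subset_univ _)
  have hae := hgΩ.weakGrad_ae_eq hΩ
  refine ⟨⟨⟨mw.restrict Ω, W, hgΩ, mW.restrict Ω⟩, fun δ hδ => ?_⟩, hae⟩
  -- δ may be infinite, and the final strict inequality (two thirds below the whole) needs a finite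
  -- quantity, hence `min δ 1`.
  have hδ3 : 0 < min δ 1 / 3 := ENNReal.div_pos (by positivity) (by norm_num)
  have hwsupp : tsupport w ⊆ tsupport χ := tsupport_mul_subset_left
  have hwc : HasCompactSupport w := hc.mul_right
  obtain ⟨η₁, hη₁, h1⟩ := exists_eLpNorm_mollify_sub_le hp.le mw hδ3
  obtain ⟨η₂, hη₂, h2⟩ := exists_eLpNorm_mollify_sub_le hp.le mW hδ3
  obtain ⟨η₃, hη₃, h3⟩ := IsCompact.exists_cthickening_subset_open hc hΩ hs
  -- The third bound keeps the support of the mollified function inside Ω.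
  set η := min (min η₁ η₂) η₃ with hη
  have hη0 : 0 < η := by positivity
  let φ : ContDiffBump (0 : Rn n) := ⟨η / 4, η / 2, by positivity, by linarith⟩
  have hφ : φ.rOut < η := by show η / 2 < η; linarith
  have hφ1 : φ.rOut < η₁ := hφ.trans_le ((min_le_left _ _).trans (min_le_left _ _))
  have hφ2 : φ.rOut < η₂ := hφ.trans_le ((min_le_left _ _).trans (min_le_right _ _))
  have hφ3 : φ.rOut < η₃ := hφ.trans_le (min_le_right _ _)
  refine ⟨mollify φ w, contDiff_mollify φ lw, hasCompactSupport_mollify φ hwc, ?_, ?_⟩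
  · exact (tsupport_mollify_subset φ w).trans
      ((Metric.cthickening_subset_of_subset _ hwsupp).trans
        ((Metric.cthickening_mono hφ3.le _).trans h3))
  · have b1 : eLpNorm (fun x => w x - mollify φ w x) (ENNReal.ofReal p) (volume.restrict Ω) ≤
        min δ 1 / 3 := by
      refine (eLpNorm_restrict_le _ _ _ _).trans ?_
      rw [show (fun x => w x - mollify φ w x) = w - mollify φ w from rfl, eLpNorm_sub_comm]
      exact h1 φ hφ1
    have b2 : eLpNorm (fun x => weakGrad Ω w x - gradient (mollify φ w) x) (ENNReal.ofReal p)
        (volume.restrict Ω) ≤ min δ 1 / 3 := by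
      have e : (fun x => weakGrad Ω w x - gradient (mollify φ w) x) =ᵐ[volume.restrict Ω]
          W - mollify φ W := by
        filter_upwards [hae] with x hx
        rw [hx, gradient_mollify φ hg]; rfl
      rw [eLpNorm_congr_ae e]
      refine (eLpNorm_restrict_le _ _ _ _).trans ?_
      rw [eLpNorm_sub_comm]
      exact h2 φ hφ2
    refine (add_le_add b1 b2).trans_lt (lt_of_lt_of_le ?_ (min_le_left δ 1))
    have hfin : min δ 1 / 3 ≠ ⊤ :=
      ENNReal.div_ne_top (ne_top_of_le_ne_top ENNReal.one_ne_top (min_le_right _ _)) (by norm_num)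
    calc min δ 1 / 3 + min δ 1 / 3 < min δ 1 / 3 + min δ 1 / 3 + min δ 1 / 3 :=
          ENNReal.lt_add_right (ENNReal.add_ne_top.2 ⟨hfin, hfin⟩) hδ3.ne'
      _ = min δ 1 := ENNReal.add_thirds _

end Cutoff

/-! ### Specialization to one phase, and finiteness of the two-phase energy -/

lemma isUniformlyConvexDensity_empty {n : ℕ} (p : ℝ) (W : Rn n → Rn n → ℝ) :
    IsUniformlyConvexDensity p ∅ W where
  nonneg := by simp
  convex := by simp
  upper := ⟨0, le_rfl, by simp⟩
  lower := ⟨0, le_rfl, by simp⟩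
  uniform := fun _ _ => ⟨0, le_rfl, by simp⟩
  measurable := by simp

lemma energy_lt_top {n : ℕ} {p : ℝ} (hp : 1 < p) {U : Set (Rn n)}
    (hbd : Bornology.IsBounded U) {σ : Rn n → ℝ → ℝ}
    (hU : IsUniformlyConvexDensity p U fun x X => energyDensity σ x ‖X‖) {G : Rn n → Rn n}
    (hG : MemLp G (ENNReal.ofReal p) (volume.restrict U)) : energy σ U G < ⊤ := by
  have : IsFiniteMeasure ((volume : Measure (Rn n)).restrict U) :=
    isFiniteMeasure_restrict.2 hbd.measure_lt_top.ne
  exact (hU.lintegral_eq hp hG).trans_lt ENNReal.ofReal_lt_top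

lemma energy_eq_zero {n : ℕ} {σ : Rn n → ℝ → ℝ} {U : Set (Rn n)} {G : Rn n → Rn n}
    (h : ∀ᵐ x ∂(volume.restrict U), G x = 0) : energy σ U G = 0 := by
  rw [energy_congr (H := fun _ => 0) h]
  simp [energy, energyDensity]

lemma MemW1p.mono_exponent {n : ℕ} {p r : ℝ} (hrp : r ≤ p) {U : Set (Rn n)}
    (hbd : Bornology.IsBounded U) {u : Rn n → ℝ} (h : MemW1p p U u) : MemW1p r U u := by
  have : IsFiniteMeasure ((volume : Measure (Rn n)).restrict U) :=
    isFiniteMeasure_restrict.2 hbd.measure_lt_top.ne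
  obtain ⟨h1, G, hG, hGp⟩ := h
  have hle := ENNReal.ofReal_le_ofReal hrp
  exact ⟨h1.mono_exponent hle, G, hG, hGp.mono_exponent hle⟩

/-- One-phase version of the stability theorem. -/
lemma convergesInLp_weakGrad_single {n : ℕ} {p : ℝ} (hp : 1 < p) {D U : Set (Rn n)}
    (hD : IsOpen D) (hUD : U ⊆ D) (hbd : Bornology.IsBounded D) {σ : Rn n → ℝ → ℝ}
    (hU : IsUniformlyConvexDensity p U fun x X => energyDensity σ x ‖X‖)
    {adm : ℝ → (Rn n → ℝ) → Prop} (hadm : ∀ ε v, adm ε v → MemW1p p D v)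
    {u₀ φ : Rn n → ℝ} {u : ℝ → Rn n → ℝ} (hφ : MemW1p p D φ)
    (h₀ : IsMinimizer (adm 0) (fun v => energy σ U (weakGrad D v)) u₀)
    (h : ∀ ε, 0 < ε → IsMinimizer (adm ε) (fun v => energy σ U (weakGrad D v)) (u ε))
    (hmid : ∀ ε v w, 0 < ε → adm ε v → adm ε w → adm ε fun x => (1 / 2) * v x + (1 / 2) * w x)
    (hup : ∀ ε v, 0 < ε → adm 0 v → adm ε fun x => 1 * v x + ε * φ x)
    (hdown : ∀ ε v, 0 < ε → adm ε v → adm 0 fun x => 1 * v x + (-ε) * φ x) :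
    ConvergesInLp p U (fun ε => weakGrad D (u ε)) (weakGrad D u₀) := by
  have mono : ∀ {v}, MemW1p p D v → MemLp (weakGrad D v) (ENNReal.ofReal p) (volume.restrict U) :=
    fun hv => (hv.memLp_weakGrad hD).mono_measure (Measure.restrict_mono hUD le_rfl)
  have m₀ := hadm _ _ h₀.1
  -- One material is the two-region result with empty second region, where every condition is
  -- vacuous and the energy is 0.
  refine (convergesInLp_weakGrad (V := ∅) (q := p) (φ := φ)
    (J := fun v => energy σ U (weakGrad D v)) hp hp hD hUD (empty_subset _) hbd hU
    (isUniformlyConvexDensity_empty p _) (fun v => by simp [energy]) m₀.hasWeakGrad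
    hφ.hasWeakGrad (fun ε hε => (hadm _ _ (h ε hε).1).hasWeakGrad)
    (energy_lt_top hp (hbd.subset hUD) hU (mono m₀)) (mono hφ) (by simp) ?_ ?_ ?_).1
  · exact fun ε hε => (h ε hε).2 _ (hmid ε _ _ hε (h ε hε).1 (hup ε _ hε h₀.1))
  · exact fun ε hε => (h ε hε).2 _ (hup ε _ hε h₀.1)
  · exact fun ε hε => h₀.2 _ (hdown ε _ hε (h ε hε).1)

/-- The two-phase problem has admissible functions of finite energy. -/
lemma exists_finite_energy {n : ℕ} {p r : ℝ} (hp : 1 < p) (hr : 1 < r) (hrp : r ≤ p)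
    {Ω A : Set (Rn n)} (hΩA : IsTwoPhaseDomain Ω A) {σ : Rn n → ℝ → ℝ}
    (hB : IsUniformlyConvexDensity p (outer Ω A) fun x X => energyDensity σ x ‖X‖)
    {f : Rn n → ℝ} (hf : MemW1p p Ω f) :
    ∃ v, (MemW1p r Ω v ∧ MemW01p r Ω fun x => v x - f x) ∧
      energy σ (outer Ω A) (weakGrad Ω v) + energy σ A (weakGrad Ω v) < ⊤ := by
  have hΩ := hΩA.isOpen_Ω
  have hAΩ : A ⊆ Ω := subset_closure.trans hΩA.closure_A_subset
  have hBΩ : outer Ω A ⊆ Ω := sdiff_subset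
  have hK : IsCompact (closure A) :=
    (hΩA.isBounded_Ω.subset hAΩ).isCompact_closure
  obtain ⟨χ, hχ, hc, hs, hone⟩ := exists_smooth_cutoff hK hΩ hΩA.closure_A_subset
  have hfr := hf.mono_exponent hrp hΩA.isBounded_Ω
  -- The cutoff is applied with exponent r for admissibility and with exponent p for the
  -- integrability of the gradient on B.
  obtain ⟨k1, k2⟩ := memW01p_cutoff hΩ hr hfr hχ hc hs
  obtain ⟨l1, -⟩ := memW01p_cutoff hΩ hp hf hχ hc hs
  have hv := hfr.linComb k1.1 1 (-1)
  have hvp := hf.linComb l1.1 1 (-1)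
  -- The competitor is f - χf. It has the boundary values of f and vanishes on A, so the possible
  -- failure of ∇f to lie in L^q(A) does not matter.
  refine ⟨fun x => 1 * f x + (-1) * (χ x * f x), ⟨hv, ?_⟩, ?_⟩
  · exact k1.of_linComb hΩ hr k1 (-1) 0 fun x => by ring
  · refine ENNReal.add_lt_top.2 ⟨energy_lt_top hp (hΩA.isBounded_Ω.subset hBΩ) hB
      ((hvp.memLp_weakGrad hΩ).mono_measure (Measure.restrict_mono hBΩ le_rfl)), ?_⟩
    rw [energy_eq_zero]
    · exact ENNReal.zero_lt_top
    · have e1 := ae_restrict_of_ae_restrict_of_subset hAΩ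
        (weakGrad_linComb hΩ hfr.hasWeakGrad k1.1.hasWeakGrad 1 (-1))
      have e2 := ae_restrict_of_ae_restrict_of_subset hAΩ k2
      filter_upwards [e1, e2, ae_restrict_mem hΩA.isOpen_A.measurableSet] with x h1 h2 hxA
      have hχx : χ x = 1 := hone x (subset_closure hxA)
      -- A is open and χ = 1 on it, so χ is locally constant at x.
      have hgx : gradient χ x = 0 := by
        have : χ =ᶠ[𝓝 x] fun _ => 1 := by
          filter_upwards [hΩA.isOpen_A.mem_nhds hxA] with y hy using hone y (subset_closure hy)
        rw [this.gradient_eq]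
        exact gradient_fun_const _ _
      rw [h1, h2, hχx, hgx]
      simp

end

end PiecewiseNonlinear

/-! ### The four boundary value problems -/

open PiecewiseNonlinear in
theorem proposition3p2 {n : ℕ} (hn : 2 ≤ n) (Ω A : Set (Rn n)) (hΩA : IsTwoPhaseDomain Ω A)
    (p q : ℝ) (hp : 1 < p) (hq : 1 < q) (σ : Rn n → ℝ → ℝ)
    (hP1 : IsCaratheodory (outer Ω A) σ) (hP2 : HasGrowth p (outer Ω A) σ)
    (hP3 : IsStronglyMonotone p (outer Ω A) σ)
    (f : Rn n → ℝ) (hf : MemW1p p Ω f) :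
    -- (i) a single material
    (A = ∅ →
      ∀ φ : Rn n → ℝ, MemW1p p Ω φ →
      ∀ (u₀ : Rn n → ℝ) (u : ℝ → Rn n → ℝ),
        IsSinglePhaseSolution p Ω σ f u₀ →
        (∀ ε : ℝ, 0 < ε → IsSinglePhaseSolution p Ω σ (fun x => f x + ε * φ x) (u ε)) →
        ConvergesInLp p Ω (fun ε => weakGrad Ω (u ε)) (weakGrad Ω u₀)) ∧
    -- (ii) two materials, of growth `p` in `B` and of growth `q` in `A`
    (IsCaratheodory A σ → HasGrowth q A σ → IsStronglyMonotone q A σ →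
      ∀ φ : Rn n → ℝ, MemW1p (min p q) Ω φ → MemW1p p (outer Ω A) φ → MemW1p q A φ →
      ∀ (u₀ : Rn n → ℝ) (u : ℝ → Rn n → ℝ),
        IsTwoPhaseSolution p q Ω A σ f u₀ →
        (∀ ε : ℝ, 0 < ε → IsTwoPhaseSolution p q Ω A σ (fun x => f x + ε * φ x) (u ε)) →
        ConvergesInLp p (outer Ω A) (fun ε => weakGrad Ω (u ε)) (weakGrad Ω u₀) ∧
        ConvergesInLp q A (fun ε => weakGrad Ω (u ε)) (weakGrad Ω u₀) ∧
        ConvergesInLp (min p q) Ω (fun ε => weakGrad Ω (u ε)) (weakGrad Ω u₀)) ∧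
    -- (iii) perfect electric insulator in `A`
    (∀ φ : Rn n → ℝ, MemW1p p (outer Ω A) φ →
      ∀ (u₀ : Rn n → ℝ) (u : ℝ → Rn n → ℝ),
        IsPEISolution p Ω A σ f u₀ →
        (∀ ε : ℝ, 0 < ε → IsPEISolution p Ω A σ (fun x => f x + ε * φ x) (u ε)) →
        ConvergesInLp p (outer Ω A) (fun ε => weakGrad (outer Ω A) (u ε))
          (weakGrad (outer Ω A) u₀)) ∧
    -- (iv) perfect electric conductor in `A`
    (∀ φ : Rn n → ℝ, MemW1p p Ω φ →
      ∀ (u₀ : Rn n → ℝ) (u : ℝ → Rn n → ℝ),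
        IsPECSolution p Ω A σ f u₀ →
        (∀ ε : ℝ, 0 < ε → IsPECSolution p Ω A σ (fun x => f x + ε * φ x) (u ε)) →
        ConvergesInLp p (outer Ω A) (fun ε => weakGrad Ω (u ε)) (weakGrad Ω u₀)) := by
  have hΩ := hΩA.isOpen_Ω
  have hbd := hΩA.isBounded_Ω
  have hBΩ : outer Ω A ⊆ Ω := sdiff_subset
  have hAΩ : A ⊆ Ω := subset_closure.trans hΩA.closure_A_subset
  have hBo : IsOpen (outer Ω A) := hΩ.sdiff isClosed_closure
  have hB := isUniformlyConvexDensity hp hP1 hP2 hP3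
  refine ⟨?_, ?_, ?_, ?_⟩
  · rintro rfl φ hφ u₀ u h₀ h
    have hout : outer Ω (∅ : Set (Rn n)) = Ω := by simp [outer]
    rw [hout] at hB
    -- The class for ε = 0 is that of the datum f. Adding εφ to both the function and the datum
    -- leaves their difference unchanged, whence the coefficients 1 and 0 below.
    refine convergesInLp_weakGrad_single hp hΩ le_rfl hbd hB
      (adm := fun ε v => MemW1p p Ω v ∧ MemW01p p Ω fun x => v x - (f x + ε * φ x))
      (fun _ _ hv => hv.1) hφ (by simpa [IsSinglePhaseSolution] using h₀) h ?_ ?_ ?_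
    · rintro ε v w - ⟨hv, hv'⟩ ⟨hw, hw'⟩
      exact ⟨hv.linComb hw _ _, hv'.of_linComb hΩ hp hw' (1 / 2) (1 / 2) fun x => by ring⟩
    · rintro ε v - ⟨hv, hv'⟩
      exact ⟨hv.linComb hφ _ _, hv'.of_linComb hΩ hp hv' 1 0 fun x => by ring⟩
    · rintro ε v - ⟨hv, hv'⟩
      exact ⟨hv.linComb hφ _ _, hv'.of_linComb hΩ hp hv' 1 0 fun x => by ring⟩
  · intro hA1 hA2 hA3 φ hφ hφB hφA u₀ u h₀ h
    have hA := isUniformlyConvexDensity hq hA1 hA2 hA3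
    have hr : 1 < min p q := lt_min hp hq
    obtain ⟨v, hv, hvfin⟩ := exists_finite_energy hp hr (min_le_left p q) hΩA hB hf
    have hfin := (h₀.2 v hv).trans_lt hvfin
    -- The weak gradient of φ on Ω restricts to a weak gradient on each region, where uniqueness
    -- identifies it with the more integrable one.
    have gB : MemLp (weakGrad Ω φ) (ENNReal.ofReal p) (volume.restrict (outer Ω A)) :=
      (memLp_congr_ae ((hφ.hasWeakGrad.mono hBΩ).ae_eq hBo hφB.hasWeakGrad)).2
        (hφB.memLp_weakGrad hBo)
    have gA : MemLp (weakGrad Ω φ) (ENNReal.ofReal q) (volume.restrict A) :=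
      (memLp_congr_ae ((hφ.hasWeakGrad.mono hAΩ).ae_eq hΩA.isOpen_A hφA.hasWeakGrad)).2
        (hφA.memLp_weakGrad hΩA.isOpen_A)
    obtain ⟨c1, c2⟩ := convergesInLp_weakGrad hp hq hΩ hBΩ hAΩ hbd hB hA
      (J := fun v => energy σ (outer Ω A) (weakGrad Ω v) + energy σ A (weakGrad Ω v))
      (fun _ => rfl) (u := u) h₀.1.1.hasWeakGrad hφ.hasWeakGrad
      (fun ε hε => (h ε hε).1.1.hasWeakGrad) hfin gB gA
      (fun ε hε => (h ε hε).2 _ ⟨(h ε hε).1.1.linComb (h₀.1.1.linComb hφ 1 ε) _ _,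
        (h ε hε).1.2.of_linComb hΩ hr h₀.1.2 (1 / 2) (1 / 2) fun x => by ring⟩)
      (fun ε hε => (h ε hε).2 _ ⟨h₀.1.1.linComb hφ 1 ε,
        h₀.1.2.of_linComb hΩ hr h₀.1.2 1 0 fun x => by ring⟩)
      (fun ε hε => h₀.2 _ ⟨(h ε hε).1.1.linComb hφ 1 (-ε),
        (h ε hε).1.2.of_linComb hΩ hr h₀.1.2 1 0 fun x => by ring⟩)
    refine ⟨c1, c2, c1.union hp hq hbd hBo.measurableSet hΩA.isOpen_A.measurableSet hBΩ hAΩ ?_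
      (h₀.1.1.memLp_weakGrad hΩ).1 (fun ε hε => ((h ε hε).1.1.memLp_weakGrad hΩ).1) c2⟩
    -- A and B cover Ω except for the frontier of A, a null set.
    have hnull : ∀ᵐ x ∂(volume.restrict Ω), x ∉ frontier A :=
      ae_restrict_of_ae (measure_eq_zero_iff_ae_notMem.1
        hΩA.lipschitz_A.volume_frontier_eq_zero)
    filter_upwards [hnull, ae_restrict_mem hΩ.measurableSet] with x hx hxΩ
    by_cases hxA : x ∈ closure A
    · exact Or.inr (by
        by_contra hn
        exact hx ⟨hxA, fun hi => hn (interior_subset hi)⟩)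
    · exact Or.inl ⟨hxΩ, hxA⟩
  · intro φ hφ u₀ u h₀ h
    refine convergesInLp_weakGrad_single hp hBo le_rfl (hbd.subset hBΩ) hB
      (adm := fun ε v => MemW1p p (outer Ω A) v ∧
        VanishesOnBdry p Ω (outer Ω A) fun x => v x - (f x + ε * φ x))
      (fun _ _ hv => hv.1) hφ (by simpa [IsPEISolution] using h₀) h ?_ ?_ ?_
    · rintro ε v w - ⟨hv, hv'⟩ ⟨hw, hw'⟩
      exact ⟨hv.linComb hw _ _, hv'.of_linComb hBo hp hw' (1 / 2) (1 / 2) fun x => by ring⟩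
    · rintro ε v - ⟨hv, hv'⟩
      exact ⟨hv.linComb hφ _ _, hv'.of_linComb hBo hp hv' 1 0 fun x => by ring⟩
    · rintro ε v - ⟨hv, hv'⟩
      exact ⟨hv.linComb hφ _ _, hv'.of_linComb hBo hp hv' 1 0 fun x => by ring⟩
  · intro φ hφ u₀ u h₀ h
    -- The difference of two solutions is an admissible direction whose gradient vanishes in `A`.
    have h1 := (h 1 one_pos).1
    have hd : MemW1p p Ω fun x => 1 * u 1 x + (-1) * u₀ x := h1.1.linComb h₀.1.1 1 (-1)
    have hdA : ∀ᵐ x ∂(volume.restrict A),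
        weakGrad Ω (fun x => 1 * u 1 x + (-1) * u₀ x) x = 0 := by
      filter_upwards [ae_restrict_of_ae_restrict_of_subset hAΩ
        (weakGrad_linComb hΩ h1.1.hasWeakGrad h₀.1.1.hasWeakGrad 1 (-1)), h1.2.2, h₀.1.2.2]
        with x e1 e2 e3
      rw [e1, e2, e3]; simp
    have hlinA : ∀ {v w : Rn n → ℝ}, MemW1p p Ω v → MemW1p p Ω w →
        (∀ᵐ x ∂(volume.restrict A), weakGrad Ω v x = 0) →
        (∀ᵐ x ∂(volume.restrict A), weakGrad Ω w x = 0) → ∀ a b : ℝ,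
        ∀ᵐ x ∂(volume.restrict A), weakGrad Ω (fun x => a * v x + b * w x) x = 0 := by
      intro v w hv hw hvA hwA a b
      filter_upwards [ae_restrict_of_ae_restrict_of_subset hAΩ
        (weakGrad_linComb hΩ hv.hasWeakGrad hw.hasWeakGrad a b), hvA, hwA] with x e1 e2 e3
      rw [e1, e2, e3]; simp
    -- The direction d = u₁ - u₀ only has to agree with φ on ∂Ω: v + εd - (f + εφ) = (v - f) + ε(d -
    -- φ).
    have hdV : MemW01p p Ω fun x => (1 * u 1 x + (-1) * u₀ x) - φ x :=
      h1.2.1.of_linComb hΩ hp h₀.1.2.1 1 (-1) fun x => by ring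
    refine convergesInLp_weakGrad_single hp hΩ hBΩ hbd hB
      (adm := fun ε v => MemW1p p Ω v ∧ (MemW01p p Ω fun x => v x - (f x + ε * φ x)) ∧
        ∀ᵐ x ∂(volume.restrict A), weakGrad Ω v x = 0)
      (fun _ _ hv => hv.1) hd (by simpa [IsPECSolution] using h₀) h ?_ ?_ ?_
    · rintro ε v w - ⟨hv, hv', hvA⟩ ⟨hw, hw', hwA⟩
      exact ⟨hv.linComb hw _ _, hv'.of_linComb hΩ hp hw' (1 / 2) (1 / 2) fun x => by ring,
        hlinA hv hw hvA hwA _ _⟩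
    · rintro ε v - ⟨hv, hv', hvA⟩
      exact ⟨hv.linComb hd _ _, hv'.of_linComb hΩ hp hdV 1 ε fun x => by ring,
        hlinA hv hd hvA hdA _ _⟩
    · rintro ε v - ⟨hv, hv', hvA⟩
      exact ⟨hv.linComb hd _ _, hv'.of_linComb hΩ hp hdV 1 (-ε) fun x => by ring,
        hlinA hv hd hvA hdA _ _⟩
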